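/- **Conventions.** The group $\mathsf{PGL}_2(\mathbb R)$ acts on $\mathbb H^2\cup\partial\mathbb H^2$, where $\partial\mathbb H^2=\mathbb R\cup\{\infty\}$. The limit set $\Lambda(\Gamma)\subset\partial\mathbb H^2$ of a discrete subgroup $\Gamma$ is the set of accumulation points of a $\Gamma$-orbit in $\mathbb H^2$. Let $d\ge 1$, and let $\mathcal F(\mathbb R^d)$ be the manifold of complete flags $F=(F^1\subset\dots\subset F^{d-1})$, $\dim F^k=k$. Flags $F,G$ are *transverse* if $F^k+G^{d-k}=\mathbb R^d$ for all $1\le k\le d-1$. A representation $\rho:\Gamma\to\mathsf{PGL}_d(\mathbb R)$ is *Borel transverse* if there is a continuous map $\xi:\Lambda(\Gamma)\to\mathcal F(\mathbb R^d)$ (its *limit map*) such that * $\xi(\gamma x)=\rho(\gamma)\xi(x)$ for all $\gamma\in\Gamma$, $x\in\Lambda(\Gamma)$; * $\xi(x),\xi(y)$ are transverse for all $x\ne y$ in $\Lambda(\Gamma)$; * if $\gamma_n\in\Gamma$, $b_0\in\mathbb H^2$ and $x,y\in\Lambda(\Gamma)$ satisfy $\gamma_n b_0\to x$ and $\gamma_n^{-1}b_0\to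 y$, then $\rho(\gamma_n)F\to\xi(x)$ for every flag $F$ transverse to $\xi(y)$. A subgroup $\Gamma$ is *geometrically finite* if it is discrete, finitely generated and non-elementary (i.e. $\Lambda(\Gamma)$ is infinite). Let $U(\Gamma)$ be the set of unit tangent vectors $v$ of $\mathbb H^2$ whose geodesic has both endpoints $v^\pm\in\Lambda(\Gamma)$, and let $\varphi_t$ be the geodesic flow. A representation $\rho$ of a geometrically finite $\Gamma$ is *cusped Borel Anosov* if there are a continuous, $\rho$-equivariant, transverse map $\xi:\Lambda(\Gamma)\to\mathcal F(\mathbb R^d)$ (its *limit map*), a continuous, $\rho$-equivariant family of norms $\|\cdot\|_v$ on $\mathbb R^d$, $v\in U(\Gamma)$ (elements of $\mathsf{PGL}_d(\mathbb R)$ acting through linear representatives of determinant $\pm1$), and constants $C,a>0$ such that $$\frac{\|Y\|_{\varphi_t v}}{\|Z\|_{\varphi_t v}}\le Ce^{-at}\,\frac{\|Y\|_v}{\|Z\|_v}$$ for all $1\le k\le d-1$, $v\in U(\Gamma)$, $t\ge0$ and non-zero $Y\in\xi(v^+)^k$, $Z\in\xi(v^-)^{d-k}$. An upper triangular unipotent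 matrix is *totally positive* if all its minors with row indices $i_1<\dots<i_k$ and column indices $j_1<\dots<j_k$ such that $i_p\le j_p$ for all $p$ (those not forced to vanish) are positive. For an ordered basis $\mathcal B$ of $\mathbb R^d$ let $U_{>0}(\mathcal B)\subset\mathsf{PGL}_d(\mathbb R)$ be the set of elements represented in $\mathcal B$ by such a matrix. For $n\ge3$, a tuple $(F_1,\dots,F_n)$ of complete flags is *positive* (Fock–Goncharov) if $F_1,F_n$ are transverse and there are a basis $\mathcal B=(e_1,\dots,e_d)$ with $e_i\in F_1^i\cap F_n^{d-i+1}$ for all $i$ (where $F^d=\mathbb R^d$) and $u_2,\dots,u_{n-1}\in U_{>0}(\mathcal B)$ with $F_j=(u_{n-1}\cdots u_j)F_n$ for $2\le j\le n-1$. A map from a subset of the circle $\partial\mathbb H^2$ to $\mathcal F(\mathbb R^d)$ is *positive* if it sends every cyclically ordered $n$-tuple of distinct points, for every $n\ge3$, to a positive tuple. Finally, $\rho$ is *Hitchin* if there is a continuous, $\rho$-equivariant, positive map $\Lambda(\Gamma)\to\mathcal F(\mathbb R^d)$. **Theorem.** Let $\Gamma\subset\mathsf{PGL}_2(\mathbb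 R)$ be a discrete subgroup with $\Lambda(\Gamma)=\partial\mathbb H^2$, and let $\rho:\Gamma\to\mathsf{PGL}_d(\mathbb R)$ be a representation whose image contains a unipotent element with a single Jordan block. 1. If $\rho$ is Borel transverse, then $\rho$ is Hitchin, and its limit map is positive. 2. If $\Gamma$ is geometrically finite and $\rho$ is cusped Borel Anosov, then $\rho$ is Hitchin, and its limit map is positive. -/

import Mathlib

open scoped MatrixGroups UpperHalfPlane
open Filter Topology

namespace HitchinRigidity

/-! ### The projective linear groups and the hyperbolic plane -/

/-- `PGL(d, ℝ)` carries the quotient topology of `GL(d, ℝ)`. -/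
instance instTopologicalSpacePGL (d : ℕ) : TopologicalSpace PGL(Fin d, ℝ) :=
  TopologicalSpace.coinduced (Matrix.ProjGenLinGroup.mk (n := Fin d) (R := ℝ)) inferInstance

/-- `PGL(2, ℝ)` acts on `∂ℍ² = ℝ ∪ {∞} = ℝP¹` by Möbius transformations. -/
noncomputable instance instMulActionBoundary : MulAction PGL(Fin 2, ℝ) (OnePoint ℝ) :=
  Matrix.ProjGenLinGroup.mulActionOfGL (by
    intro u x
    cases x with
    | infty => simp [OnePoint.smul_infty_eq_ite]
    | coe t => simp [OnePoint.smul_some_eq_ite])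

/-- The inclusion of `ℍ²` into the Riemann sphere `ℂ ∪ {∞}`. -/
def interiorPoint (z : ℍ) : OnePoint ℂ := ((z : ℂ) : OnePoint ℂ)

/-- The inclusion of `∂ℍ² = ℝ ∪ {∞}` into the Riemann sphere. The closed disc `ℍ² ∪ ∂ℍ²` is the
closure of `ℍ²` in the Riemann sphere, with the subspace topology. -/
def boundaryPoint (x : OnePoint ℝ) : OnePoint ℂ := x.map Complex.ofReal

/-- The sequence (or filtered family) `z` of points of `ℍ²` converges to `x ∈ ∂ℍ²` in the
closed disc `ℍ² ∪ ∂ℍ²`. -/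
def TendstoBoundary {ι : Type*} (z : ι → ℍ) (l : Filter ι) (x : OnePoint ℝ) : Prop :=
  Tendsto (fun i => interiorPoint (z i)) l (𝓝 (boundaryPoint x))

/-- The limit set `Λ(Γ)`: the accumulation points in `∂ℍ²` of a `Γ`-orbit in `ℍ²`. -/
def limitSet (Γ : Subgroup PGL(Fin 2, ℝ)) : Set (OnePoint ℝ) :=
  {x | ∃ (b₀ : ℍ) (γ : ℕ → Γ), TendstoBoundary (fun n => (γ n : PGL(Fin 2, ℝ)) • b₀) atTop x}

/-- A discrete subgroup of `PGL(2, ℝ)` is non-elementary if its limit set is infinite. -/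
def IsNonElementary (Γ : Subgroup PGL(Fin 2, ℝ)) : Prop := (limitSet Γ).Infinite

/-- Geometrically finite subgroups: finitely generated, non-elementary, discrete. -/
structure IsGeometricallyFinite (Γ : Subgroup PGL(Fin 2, ℝ)) : Prop where
  discrete : DiscreteTopology Γ
  nonElementary : IsNonElementary Γ
  fg : Γ.FG

/-- A tuple of points of `∂ℍ² = ℝ ∪ {∞}` is cyclically ordered, `x₀ < x₁ < ⋯ < xₘ < x₀`. The
circle is cut open at `∞`, which is the largest point of the resulting linear order. -/
def IsCyclicallyOrdered {n : ℕ} (x : Fin n → OnePoint ℝ) : Prop :=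
  let t : Fin n → WithTop ℝ := fun i => (x i).elim ⊤ (fun r => (r : WithTop ℝ))
  ∀ i j k : Fin n, i < j → j < k →
    (t i < t j ∧ t j < t k) ∨ (t j < t k ∧ t k < t i) ∨ (t k < t i ∧ t i < t j)

/-! ### Complete flags -/

/-- Complete flags `F⁰ ⊂ F¹ ⊂ ⋯ ⊂ Fᵈ` in `ℝᵈ`, with `dim Fᵏ = k`; so `F⁰ = 0` and `Fᵈ = ℝᵈ`. -/
@[ext]
structure CompleteFlag (d : ℕ) where
  /-- the `k`-dimensional subspace -/
  sub : Fin (d + 1) → Submodule ℝ (Fin d → ℝ)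
  finrank_sub : ∀ k, Module.finrank ℝ (sub k) = k
  mono : Monotone sub

/-- The linear automorphism of `ℝᵈ` given by an invertible matrix. -/
noncomputable def glEquiv {d : ℕ} (g : GL (Fin d) ℝ) : (Fin d → ℝ) ≃ₗ[ℝ] (Fin d → ℝ) :=
  (Matrix.GeneralLinearGroup.toLin g).toLinearEquiv

lemma glEquiv_apply {d : ℕ} (g : GL (Fin d) ℝ) (v : Fin d → ℝ) :
    glEquiv g v = (g : Matrix (Fin d) (Fin d) ℝ).mulVec v := rfl

/-- `GL(d, ℝ)` acts on complete flags by taking images of subspaces. -/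
noncomputable instance instMulActionGLFlag (d : ℕ) : MulAction (GL (Fin d) ℝ) (CompleteFlag d) where
  smul g F :=
    { sub := fun k => (F.sub k).map (glEquiv g : (Fin d → ℝ) →ₗ[ℝ] (Fin d → ℝ))
      finrank_sub := fun k => by
        rw [LinearEquiv.finrank_map_eq, F.finrank_sub]
      mono := fun _ _ h => Submodule.map_mono (F.mono h) }
  one_smul F := by
    refine CompleteFlag.ext (funext fun k => ?_)
    change (F.sub k).map _ = F.sub k
    have h : (glEquiv (1 : GL (Fin d) ℝ) : (Fin d → ℝ) →ₗ[ℝ] (Fin d → ℝ)) = LinearMap.id :=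
      LinearMap.ext fun v => by simp [glEquiv_apply]
    rw [h, Submodule.map_id]
  mul_smul g h F := by
    refine CompleteFlag.ext (funext fun k => ?_)
    change (F.sub k).map _ = ((F.sub k).map _).map _
    rw [← Submodule.map_comp]
    congr 1
    refine LinearMap.ext fun v => ?_
    simp [glEquiv_apply]

lemma sub_smul {d : ℕ} (g : GL (Fin d) ℝ) (F : CompleteFlag d) (k : Fin (d + 1)) :
    (g • F).sub k = (F.sub k).map (glEquiv g : (Fin d → ℝ) →ₗ[ℝ] (Fin d → ℝ)) := rfl

/-- The induced action of `PGL(d, ℝ)` on complete flags. -/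
noncomputable instance instMulActionPGLFlag (d : ℕ) :
    MulAction PGL(Fin d, ℝ) (CompleteFlag d) :=
  Matrix.ProjGenLinGroup.mulActionOfGL (by
    intro u F
    refine CompleteFlag.ext (funext fun k => ?_)
    rw [sub_smul]
    have key : ∀ v, glEquiv (Matrix.GeneralLinearGroup.scalar (Fin d) u) v = (u : ℝ) • v := by
      intro v
      rw [glEquiv_apply, Matrix.GeneralLinearGroup.coe_scalar]
      simp
    ext v
    simp only [Submodule.mem_map, LinearEquiv.coe_coe, key]
    constructor
    · rintro ⟨w, hw, rfl⟩
      exact Submodule.smul_mem _ _ hw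
    · intro hv
      exact ⟨(u : ℝ)⁻¹ • v, Submodule.smul_mem _ _ hv, by simp [smul_smul]⟩)

/-- The standard flag: `Fᵏ` is spanned by the first `k` vectors of the standard basis. -/
noncomputable def standardFlag (d : ℕ) : CompleteFlag d where
  sub k := Submodule.span ℝ (Pi.basisFun ℝ (Fin d) '' {j | (j : ℕ) < k})
  finrank_sub k := by
    have hli := (Pi.basisFun ℝ (Fin d)).linearIndependent
    have h := finrank_span_set_eq_card (R := ℝ)
      (s := Pi.basisFun ℝ (Fin d) '' {j | (j : ℕ) < k})
      (hli.linearIndepOn_id.mono (Set.image_subset_range _ _))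
    rw [h, ← Set.ncard_eq_toFinset_card',
      Set.ncard_image_of_injective _ (Pi.basisFun ℝ (Fin d)).injective,
      Set.ncard_eq_toFinset_card']
    have hk : (k : ℕ) ≤ d := Nat.lt_succ_iff.mp k.2
    simp [Fin.card_filter_val_lt, hk]
  mono k l h := Submodule.span_mono (Set.image_mono fun j (hj : (j : ℕ) < k) =>
    show (j : ℕ) < l from lt_of_lt_of_le hj h)

/-- The topology of the flag manifold `GL(d, ℝ) / B`, where `B` is the stabilizer of the standard
flag: the quotient topology of the (surjective) orbit map `g ↦ g • standardFlag`. -/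
noncomputable instance instTopologicalSpaceFlag (d : ℕ) : TopologicalSpace (CompleteFlag d) :=
  TopologicalSpace.coinduced (fun g : GL (Fin d) ℝ => g • standardFlag d) inferInstance

/-- `F` and `G` are transverse: `Fᵏ + Gᵈ⁻ᵏ = ℝᵈ` for all `k`. -/
def CompleteFlag.Transverse {d : ℕ} (F G : CompleteFlag d) : Prop :=
  ∀ k : Fin (d + 1), F.sub k ⊔ G.sub k.rev = ⊤

/-! ### Positivity -/

/-- An upper triangular unipotent matrix is totally positive if its non-trivial minors, i.e. those
with row indices `i₁ < ⋯ < iₖ` and column indices `j₁ < ⋯ < jₖ` such that `iₚ ≤ jₚ` for all `p`,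
are positive (every other minor vanishes because the matrix is upper triangular). -/
structure IsTotallyPositiveUnipotent {d : ℕ} (M : Matrix (Fin d) (Fin d) ℝ) : Prop where
  upper : ∀ i j, j < i → M i j = 0
  diag : ∀ i, M i i = 1
  minors : ∀ (k : ℕ) (I J : Fin k ↪o Fin d), (∀ p, I p ≤ J p) → 0 < (M.submatrix I J).det

/-- `U_{>0}(b)`: the elements of `PGL(d, ℝ)` that are represented in the basis `b` by an upper
triangular, unipotent, totally positive matrix. -/
def positiveUnipotents {d : ℕ} (b : Module.Basis (Fin d) ℝ (Fin d → ℝ)) : Set PGL(Fin d, ℝ) :=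
  {u | ∃ g : GL (Fin d) ℝ, Matrix.ProjGenLinGroup.mk g = u ∧
    IsTotallyPositiveUnipotent
      (LinearMap.toMatrix b b (Matrix.toLin' (g : Matrix (Fin d) (Fin d) ℝ)))}

/-- A tuple `(F₀, …, Fₘ)` of complete flags is positive (Fock and Goncharov): `F₀` and `Fₘ` are
transverse, and there are a basis `e₀, …, e_{d-1}` with `eᵢ ∈ F₀ⁱ⁺¹ ∩ Fₘᵈ⁻ⁱ` and elements
`u₁, …, u_{m-1}` of `U_{>0}(e)` such that `Fⱼ = (u_{m-1} ⋯ uⱼ) • Fₘ` for `0 < j < m`. -/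
def IsPositiveTuple {d m : ℕ} (F : Fin (m + 1) → CompleteFlag d) : Prop :=
  (F 0).Transverse (F (Fin.last m)) ∧
  ∃ (b : Module.Basis (Fin d) ℝ (Fin d → ℝ)) (u : ℕ → PGL(Fin d, ℝ)),
    (∀ j, 0 < j → j < m → u j ∈ positiveUnipotents b) ∧
    (∀ i : Fin d, b i ∈ (F 0).sub i.succ ⊓ (F (Fin.last m)).sub i.castSucc.rev) ∧
    ∀ j : Fin (m + 1), 0 < (j : ℕ) → (j : ℕ) < m →
      F j = ((List.Ico j m).reverse.map u).prod • F (Fin.last m)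

/-- A map on a subset `S` of the circle is positive if it sends cyclically ordered `n`-tuples of
points of `S` to positive tuples of flags, for all `n ≥ 3` (here `n = m + 1`). -/
def IsPositiveMap {d : ℕ} (S : Set (OnePoint ℝ)) (ξ : OnePoint ℝ → CompleteFlag d) : Prop :=
  ∀ m : ℕ, 2 ≤ m → ∀ x : Fin (m + 1) → OnePoint ℝ, (∀ i, x i ∈ S) → IsCyclicallyOrdered x →
    IsPositiveTuple (fun i => ξ (x i))

/-! ### Classes of representations

Maps `ξ : Λ(Γ) → F(ℝᵈ)` are written as functions on all of `∂ℍ²`, of which only the restriction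
to `Λ(Γ)` is ever used. -/

section Representations

variable {d : ℕ} (Γ : Subgroup PGL(Fin 2, ℝ)) (ρ : Γ →* PGL(Fin d, ℝ))
  (ξ : OnePoint ℝ → CompleteFlag d)

/-- `ξ` is `ρ`-equivariant on `Λ(Γ)`. -/
def IsEquivariant : Prop :=
  ∀ (γ : Γ), ∀ x ∈ limitSet Γ, ξ ((γ : PGL(Fin 2, ℝ)) • x) = ρ γ • ξ x

/-- `ξ` is transverse on `Λ(Γ)`. -/
def IsTransverseMap : Prop :=
  ∀ x ∈ limitSet Γ, ∀ y ∈ limitSet Γ, x ≠ y → (ξ x).Transverse (ξ y)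

/-- `ξ` is strongly dynamics preserving. -/
def IsStronglyDynamicsPreserving : Prop :=
  ∀ (γ : ℕ → Γ) (b₀ : ℍ), ∀ x ∈ limitSet Γ, ∀ y ∈ limitSet Γ,
    TendstoBoundary (fun n => (γ n : PGL(Fin 2, ℝ)) • b₀) atTop x →
    TendstoBoundary (fun n => (γ n : PGL(Fin 2, ℝ))⁻¹ • b₀) atTop y →
    ∀ F : CompleteFlag d, F.Transverse (ξ y) →
      Tendsto (fun n => ρ (γ n) • F) atTop (𝓝 (ξ x))

/-- `ξ` is a limit map of the Borel transverse representation `ρ`. -/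
structure IsBorelTransverseLimitMap : Prop where
  continuousOn : ContinuousOn ξ (limitSet Γ)
  equivariant : IsEquivariant Γ ρ ξ
  transverse : IsTransverseMap Γ ξ
  dynamics : IsStronglyDynamicsPreserving Γ ρ ξ

/-- Borel transverse representations, i.e. `P_Δ`-transverse ones with `Δ = {1, …, d - 1}`. -/
def IsBorelTransverse : Prop := ∃ ξ, IsBorelTransverseLimitMap (d := d) Γ ρ ξ

/-- Hitchin representations: those with a continuous, equivariant, positive map
`Λ(Γ) → F(ℝᵈ)`. -/
def IsHitchin : Prop :=
  ∃ ξ : OnePoint ℝ → CompleteFlag d,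
    ContinuousOn ξ (limitSet Γ) ∧ IsEquivariant Γ ρ ξ ∧ IsPositiveMap (limitSet Γ) ξ

/-- `U(Γ)`: the unit tangent vectors of `ℍ²` whose forward and backward endpoints lie in `Λ(Γ)`.
A unit tangent vector `v` is given by the unit speed geodesic line `c` with `c'(0) = v`, i.e. by
an isometric embedding `c : ℝ → ℍ²`; the topology is that of pointwise convergence, and the
geodesic flow is `φ_t(c) = c(t + ·)`. -/
def unitVectors : Set (ℝ → ℍ) :=
  {c | Isometry c ∧ (∃ x ∈ limitSet Γ, TendstoBoundary c atTop x) ∧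
    ∃ y ∈ limitSet Γ, TendstoBoundary c atBot y}

/-- A continuous `ρ`-equivariant family of norms `‖·‖_v` on `ℝᵈ`, `v ∈ U(Γ)`, i.e. a continuous
norm on the flat bundle over `Γ \ U(Γ)` associated with `ρ`. For equivariance, an element of
`PGL(d, ℝ)` acts through its linear representatives of determinant `±1`, which are unique up to
sign. Only the values of `N` on `U(Γ)` are ever used. -/
structure IsEquivariantNorm (N : (ℝ → ℍ) → Seminorm ℝ (Fin d → ℝ)) : Prop where
  definite : ∀ c ∈ unitVectors Γ, ∀ Y, N c Y = 0 → Y = 0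
  continuousOn : ContinuousOn (fun p : (ℝ → ℍ) × (Fin d → ℝ) => N p.1 p.2)
    (unitVectors Γ ×ˢ Set.univ)
  equivariant : ∀ (γ : Γ), ∀ c ∈ unitVectors Γ, ∀ g : GL (Fin d) ℝ,
    Matrix.ProjGenLinGroup.mk g = ρ γ → |(g : Matrix (Fin d) (Fin d) ℝ).det| = 1 →
    ∀ Y, N (fun t => (γ : PGL(Fin 2, ℝ)) • c t)
      ((g : Matrix (Fin d) (Fin d) ℝ).mulVec Y) = N c Y

/-- `ξ` is a limit map of the cusped Borel Anosov representation `ρ`: it is continuous,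
equivariant and transverse, and for some continuous equivariant family of norms the geodesic flow
contracts `Hom(ξ^{d-k}(v⁻), ξ^k(v⁺))` exponentially for all `k`, that is,
`‖Y‖_{φ_t v} / ‖Z‖_{φ_t v} ≤ C e^{-at} ‖Y‖_v / ‖Z‖_v` for all `v ∈ U(Γ)`, `t ≥ 0` and non-zero
`Y ∈ ξ^k(v⁺)`, `Z ∈ ξ^{d-k}(v⁻)`. -/
structure IsCuspedBorelAnosovLimitMap : Prop where
  continuousOn : ContinuousOn ξ (limitSet Γ)
  equivariant : IsEquivariant Γ ρ ξ
  transverse : IsTransverseMap Γ ξ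
  contraction : ∃ N : (ℝ → ℍ) → Seminorm ℝ (Fin d → ℝ), IsEquivariantNorm Γ ρ N ∧
    ∃ C a : ℝ, 0 < C ∧ 0 < a ∧
      ∀ c ∈ unitVectors Γ, ∀ x ∈ limitSet Γ, ∀ y ∈ limitSet Γ,
        TendstoBoundary c atTop x → TendstoBoundary c atBot y →
        ∀ k : Fin (d + 1), ∀ Y ∈ (ξ x).sub k, ∀ Z ∈ (ξ y).sub k.rev, Y ≠ 0 → Z ≠ 0 →
          ∀ t : ℝ, 0 ≤ t →
            N (fun s => c (t + s)) Y / N (fun s => c (t + s)) Z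
              ≤ C * Real.exp (-a * t) * (N c Y / N c Z)

/-- Cusped Borel Anosov representations (of geometrically finite groups `Γ`). -/
def IsCuspedBorelAnosov : Prop := ∃ ξ, IsCuspedBorelAnosovLimitMap (d := d) Γ ρ ξ

end Representations

/-- The unipotent Jordan block of size `d`. -/
def jordanBlock (d : ℕ) : Matrix (Fin d) (Fin d) ℝ :=
  Matrix.of fun i j => if i = j ∨ (i : ℕ) + 1 = j then 1 else 0

/-- `u ∈ PGL(d, ℝ)` is unipotent with a single Jordan block: it has a linear representative that
is conjugate to the unipotent Jordan block of size `d`. -/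
def IsSingleBlockUnipotent {d : ℕ} (u : PGL(Fin d, ℝ)) : Prop :=
  ∃ g P : GL (Fin d) ℝ, Matrix.ProjGenLinGroup.mk g = u ∧
    ((P⁻¹ * g * P : GL (Fin d) ℝ) : Matrix (Fin d) (Fin d) ℝ) = jordanBlock d

end HitchinRigidity

/-!
Only three properties of the limit map `ξ` are needed: it is continuous and transverse on the whole
circle, and it intertwines some projective transformation `γ` of the circle with a linear
representative `g` of a unipotent element with a single Jordan block.

*Parabolicity of `γ`* (`exists_unique_fixedPoint`). If `d = 1`, there is only one flag. If `d ≥ 2`,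
the unipotent `g` pushes every line towards the kernel of `g - 1`, which is a line. Hence at any
accumulation point `p` of a forward `γ`-orbit the line of the flag `ξ p` is this kernel, and so it
is at every fixed point of `γ`. By transversality at most one point of the circle has this property;
so `γ` has a single fixed point `p`, and it acts as a nontrivial translation `t ↦ t + β` in an
affine chart centred at `p`.

*One positive tuple of each size* (`IsRegularUnipotent.exists_isPositiveTuple`). Let `x` be another
point. In a basis adapted to the transverse flags `ξ p` and `ξ x`, suitably rescaled, `g` is
`1 + N` with `N` strictly upper triangular and with ones on the superdiagonal. As `n → ∞`, the entries
of `(1 + N) ^ n`, suitably normalized, tend to those of the exponential of a Jordan block, which is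
totally positive; so `g ^ n` is totally positive for large `n`
(`eventually_isTotallyPositiveUnipotent_pow`), and `ξ p` together with iterates of `ξ x` under
`g ^ n` forms positive tuples. They are the images of cyclically ordered tuples of the circle.

*Positivity is open and closed among tuples of pairwise transverse flags*
(`isPositiveTuple_of_isPreconnected`). With respect to a frame for the first flag, the other flags are
images of the opposite flag under unipotent upper triangular matrices that depend continuously on the
tuple, and the tuple is positive if and only if the successive quotients of these matrices are totally
positive, up to signs on the basis vectors (`isPositiveTuple_iff`). Total positivity is an open
condition. Transversality of consecutive flags says that the upper right corner minors of the quotients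
do not vanish, and a unipotent limit of totally positive matrices with nonzero corner minors is totally
positive (`isTotallyPositiveUnipotent_of_mem_closure`), by the determinantal identities of Plücker
and Desnanot-Jacobi.

Cyclically ordered tuples of points of the circle lift to increasing tuples of reals of length less than
`π`, which form a convex set. So the positive tuple above propagates along this connected set to all
cyclically ordered tuples.
-/

namespace HitchinRigidity

/-! ### Determinantal identities -/

lemma det_updateRow_updateRow_swap {n : Type*} [Fintype n] [DecidableEq n]
    (A : Matrix n n ℝ) {i j : n} (hij : i ≠ j) (x y : n → ℝ) :
    ((A.updateRow i y).updateRow j x).det = -((A.updateRow i x).updateRow j y).det := by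
  have h := Matrix.detRowAlternating.map_swap ((A.updateRow i x).updateRow j y) hij
  have e : (((A.updateRow i x).updateRow j y) ∘ Equiv.swap i j : n → n → ℝ)
      = (A.updateRow i y).updateRow j x := by
    funext l s
    simp only [Function.comp, Matrix.updateRow_apply]
    by_cases hl : l = j
    · subst hl; simp [hij]
    by_cases hl' : l = i
    · subst hl'; simp [hij]
    simp [Equiv.swap_apply_of_ne_of_ne hl' hl, hl, hl']
  rw [e] at h
  exact h

/-- The three-term Plücker relation among the determinants `[x, y]` of the matrices obtained from
a square matrix by replacing two fixed rows by `x` and `y`. It follows from Cramer's rule, which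
expresses `c` in terms of the rows of the matrix with determinant `[a, b]`. -/
lemma plucker_three_term {n : Type*} [Fintype n] [DecidableEq n]
    (A : Matrix n n ℝ) {i j : n} (hij : i ≠ j) (a b c e : n → ℝ) :
    ((A.updateRow i a).updateRow j b).det * ((A.updateRow i c).updateRow j e).det =
      ((A.updateRow i c).updateRow j b).det * ((A.updateRow i a).updateRow j e).det +
      ((A.updateRow i a).updateRow j c).det * ((A.updateRow i b).updateRow j e).det := by
  set A' := (A.updateRow i a).updateRow j b with hA'
  have h := Matrix.mulVec_cramer A'.transpose c
  have hf : ∀ x : n → ℝ, ((A.updateRow i x).updateRow j e).det =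
      (Matrix.detRowAlternating.toMultilinearMap.toLinearMap (A.updateRow j e) i) x := by
    intro x
    have : (A.updateRow i x).updateRow j e = (A.updateRow j e).updateRow i x :=
      Function.update_comm hij _ _ _
    rw [this]; rfl
  set f := Matrix.detRowAlternating.toMultilinearMap.toLinearMap (A.updateRow j e) i with hfd
  have h2 : f (A'.transpose.mulVec (A'.transpose.cramer c))
      = ∑ l, (A'.updateRow l c).det * f (A' l) := by
    have : A'.transpose.mulVec (A'.transpose.cramer c) = ∑ l, (A'.updateRow l c).det • A' l := by
      funext s
      simp [Matrix.mulVec, dotProduct, Matrix.cramer_transpose_apply, mul_comm]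
    rw [this, map_sum]
    simp
  have h0 : ∀ l, l ≠ i → l ≠ j → f (A' l) = 0 := by
    intro l hi hj
    rw [← hf]
    apply Matrix.det_zero_of_row_eq hi
    funext s
    simp [hA', Matrix.updateRow_apply, hi, hj, hij]
  rw [h, map_smul, Matrix.det_transpose, smul_eq_mul, ← Finset.add_sum_erase _ _ (Finset.mem_univ i),
    ← Finset.add_sum_erase _ _ (Finset.mem_erase.2 ⟨hij.symm, Finset.mem_univ j⟩),
    Finset.sum_eq_zero] at h2
  · have ei : A' i = a := by funext s; simp [hA', Matrix.updateRow_apply, hij]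
    have ej : A' j = b := by funext s; simp [hA', Matrix.updateRow_apply]
    have e1 : A'.updateRow i c = (A.updateRow i c).updateRow j b := by
      ext l s; simp only [hA', Matrix.updateRow_apply]; grind
    have e2 : A'.updateRow j c = (A.updateRow i a).updateRow j c := by
      ext l s; simp only [hA', Matrix.updateRow_apply]; grind
    rw [ei, ej, e1, e2] at h2
    rw [hf c, hf a, hf b, h2]; ring
  · intro l hl
    simp only [Finset.mem_erase] at hl
    rw [h0 l hl.2.1 hl.1, mul_zero]

lemma det_updateRow_single {n : ℕ} (A : Matrix (Fin (n + 1)) (Fin (n + 1)) ℝ) (i j : Fin (n + 1)) :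
    (A.updateRow i (Pi.single j 1)).det =
      (-1) ^ (i + j : ℕ) * (A.submatrix i.succAbove j.succAbove).det := by
  rw [← Matrix.adjugate_apply, Matrix.adjugate_fin_succ_eq_det_submatrix]

/-- The Desnanot–Jacobi identity (Dodgson condensation). -/
lemma desnanot_jacobi {n : ℕ} (X : Matrix (Fin (n + 2)) (Fin (n + 2)) ℝ) :
    X.det * (X.submatrix (Fin.succ ∘ Fin.castSucc) (Fin.succ ∘ Fin.castSucc)).det =
      (X.submatrix Fin.castSucc Fin.castSucc).det * (X.submatrix Fin.succ Fin.succ).det -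
      (X.submatrix Fin.castSucc Fin.succ).det * (X.submatrix Fin.succ Fin.castSucc).det := by
  have h0l : (0 : Fin (n + 2)) ≠ Fin.last (n + 1) := (Fin.last_pos).ne
  have hP := plucker_three_term X h0l (X 0) (X (Fin.last _)) (Pi.single 0 1)
    (Pi.single (Fin.last _) 1)
  have e1 : ∀ x, (X.updateRow 0 x).updateRow (Fin.last _) (X (Fin.last _)) = X.updateRow 0 x := by
    intro x
    ext l s; simp only [Matrix.updateRow_apply]; grind
  have hs : ((X.updateRow 0 (Pi.single 0 1)).submatrix Fin.castSucc Fin.castSucc) =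
      (X.submatrix Fin.castSucc Fin.castSucc).updateRow 0 (Pi.single 0 1) := by
    ext i j
    by_cases hi : i = 0
    · subst hi
      by_cases hj : j = 0
      · subst hj; simp [Matrix.updateRow_apply]
      · have : j.castSucc ≠ 0 := by simpa using hj
        simp [Matrix.updateRow_apply, hj]
    · have : i.castSucc ≠ 0 := by simpa using hi
      simp [Matrix.updateRow_apply, hi]
  rw [det_updateRow_updateRow_swap X h0l (Pi.single (Fin.last (n+1)) 1) (X (Fin.last _))] at hP
  simp only [Matrix.updateRow_eq_self, e1, det_updateRow_single, Fin.succAbove_last,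
    Fin.succAbove_zero, hs] at hP
  simp only [Fin.val_zero, Fin.val_last, Matrix.submatrix_submatrix] at hP
  have hc : (Fin.castSucc ∘ Fin.succ : Fin n → Fin (n+2)) = Fin.succ ∘ Fin.castSucc := by
    funext l; simp
  rw [hc] at hP
  have s1 : ((-1 : ℝ)) ^ (n + 1) * (-1) ^ (n + 1) = 1 := by
    rw [← mul_pow]; norm_num
  have s2 : (-1 : ℝ) ^ (n + 1 + (n + 1)) = 1 := by rw [pow_add, s1]
  simp only [s2, add_zero, zero_add, pow_zero, one_mul] at hP
  rw [hP]
  linear_combination (-(X.submatrix Fin.castSucc Fin.succ).det *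
    (X.submatrix Fin.succ Fin.castSucc).det) * s1

/-! ### Vanishing and positivity of minors -/

/-- A minor of an upper triangular matrix vanishes unless `I ≤ J`: a nonzero term of the
Leibniz expansion would inject `{i ≤ p}` into `{i < p}`. -/
lemma det_submatrix_eq_zero_of_upper {ι : Type*} [LinearOrder ι] {k : ℕ} {M : Matrix ι ι ℝ}
    (hM : ∀ i j, j < i → M i j = 0) {I J : Fin k → ι} (hI : Monotone I) (hJ : Monotone J)
    {p : Fin k} (hp : J p < I p) : (M.submatrix I J).det = 0 := by
  rw [Matrix.det_apply]
  refine Finset.sum_eq_zero fun σ _ => ?_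
  obtain ⟨i, hip, hpi⟩ : ∃ i, i ≤ p ∧ p ≤ σ i := by
    by_contra! h
    have := Finset.card_le_card_of_injOn (s := Finset.Iic p) (t := Finset.Iio p) σ
      (fun i hi => by simpa using h i (by simpa using hi)) σ.injective.injOn
    simp at this
  rw [Finset.prod_eq_zero (Finset.mem_univ i), smul_zero]
  exact hM _ _ (lt_of_le_of_lt (hJ hip) (lt_of_lt_of_le hp (hI hpi)))

/-- All minors (with increasing row and column indices) are nonnegative. -/
def IsTotallyNonneg {d : ℕ} (M : Matrix (Fin d) (Fin d) ℝ) : Prop :=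
  ∀ (k : ℕ) (I J : Fin k → Fin d), StrictMono I → StrictMono J → 0 ≤ (M.submatrix I J).det

/-- A sequence of indices without gaps. -/
def IsContiguous {d k : ℕ} (I : Fin k → Fin d) : Prop :=
  ∀ p q : Fin k, (I p : ℕ) + q = I q + p

lemma isContiguous_of_succ {d k : ℕ} {I : Fin (k + 1) → Fin d}
    (h : ∀ p : Fin k, (I p.succ : ℕ) = I p.castSucc + 1) : IsContiguous I := by
  have h0 : ∀ p : Fin (k + 1), (I p : ℕ) = I 0 + p := by
    intro p
    induction p using Fin.induction with
    | zero => simp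
    | succ p ih => rw [h, ih]; simp; omega
  intro p q
  rw [h0 p, h0 q]; omega

/-- Positivity of the minors with contiguous rows propagates to all row sets. A gap in the rows `I`
is filled with an index `b` by means of the three-term Plücker relation, which bounds a multiple
of the minor below by the product of two positive ones: a minor of smaller size, and the one in
which the index following the gap is lowered to `b`. The columns range over a class `C` that is
stable under removing the smallest index. -/
theorem minor_pos_of_contiguous_rows {d : ℕ} {M : Matrix (Fin d) (Fin d) ℝ}
    (hN : IsTotallyNonneg M) (C : ∀ k : ℕ, (Fin k → Fin d) → Prop)
    (hC : ∀ k (J : Fin (k + 1) → Fin d), C (k + 1) J → C k (J ∘ Fin.succ))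
    (hpos : ∀ (k : ℕ) (I J : Fin k → Fin d), StrictMono I → StrictMono J → IsContiguous I →
      C k J → (∀ p, I p ≤ J p) → 0 < (M.submatrix I J).det) :
    ∀ (k : ℕ) (I J : Fin k → Fin d), StrictMono I → StrictMono J → C k J → (∀ p, I p ≤ J p) →
      0 < (M.submatrix I J).det := by
  intro k
  induction k with
  | zero => intro I J _ _ _ _; simp
  | succ n ih =>
    intro I
    induction hs : ∑ p, (I p : ℕ) using Nat.strong_induction_on generalizing I with
    | _ S ihS =>
    subst hs
    intro J hI hJ hCJ hIJ
    by_cases hgap : ∀ p : Fin n, (I p.succ : ℕ) = I p.castSucc + 1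
    · exact hpos _ I J hI hJ (isContiguous_of_succ hgap) hCJ hIJ
    push Not at hgap
    obtain ⟨p, hp⟩ := hgap
    have hlt : I p.castSucc < I p.succ := hI (Fin.castSucc_lt_succ)
    have hlt' : (I p.castSucc : ℕ) + 1 < I p.succ := by
      have : (I p.castSucc : ℕ) < I p.succ := hlt
      omega
    let b : Fin d := ⟨I p.castSucc + 1, by have := (I p.succ).2; omega⟩
    have hb1 : I p.castSucc < b := by simp [b, Fin.lt_def]
    have hb2 : b < I p.succ := by simpa [b, Fin.lt_def] using hlt'
    have hne : p.castSucc ≠ p.succ := (Fin.castSucc_lt_succ).ne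
    -- lowering the index after the gap, raising the index before it
    have hIlow : StrictMono (Function.update I p.succ b) := by
      rw [Fin.strictMono_iff_lt_succ]
      intro q
      have hq := hI (Fin.castSucc_lt_succ (i := q))
      by_cases h1 : q = p
      · subst h1; simpa [Function.update_apply, hne] using hb1
      · have h2 : q.succ ≠ p.succ := by simpa using h1
        by_cases h3 : q.castSucc = p.succ
        · simp only [Function.update_apply, h2, h3, if_true, if_false]
          rw [h3] at hq; exact hb2.trans hq
        · simpa [Function.update_apply, h2, h3] using hq
    have hIup : StrictMono (Function.update I p.castSucc b) := by
      rw [Fin.strictMono_iff_lt_succ]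
      intro q
      have hq := hI (Fin.castSucc_lt_succ (i := q))
      by_cases h1 : q = p
      · subst h1; simpa [Function.update_apply, hne.symm] using hb2
      · have h2 : q.castSucc ≠ p.castSucc := by simpa using h1
        by_cases h3 : q.succ = p.castSucc
        · simp only [Function.update_apply, h2, h3, if_true, if_false]
          rw [h3] at hq; exact hq.trans hb1
        · simpa [Function.update_apply, h2, h3] using hq
    have hlowle : ∀ q, Function.update I p.succ b q ≤ I q := by
      intro q
      by_cases h : q = p.succ
      · subst h; simpa using hb2.le
      · simp [h]
    have hsum : ∑ q, (Function.update I p.succ b q : ℕ) < ∑ q, (I q : ℕ) :=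
      Finset.sum_lt_sum (fun q _ => hlowle q) ⟨p.succ, Finset.mem_univ _, by simpa using hb2⟩
    have hposlow := ihS _ hsum _ rfl J hIlow hJ hCJ fun q => (hlowle q).trans (hIJ q)
    have hsmall : 0 < (M.submatrix (I ∘ p.castSucc.succAbove) (J ∘ Fin.succ)).det := by
      refine ih _ _ (hI.comp (Fin.strictMono_succAbove _)) (hJ.comp (Fin.strictMono_succ))
        (hC _ _ hCJ) fun q => (hI.monotone ?_).trans (hIJ q.succ)
      rw [Fin.succAbove]; split_ifs
      exacts [(Fin.castSucc_lt_succ).le, le_rfl]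
    have hN1 := hN _ _ _ hIup hJ
    have hN2 := hN _ _ _ (hI.comp (Fin.strictMono_succAbove p.succ)) (hJ.comp (Fin.strictMono_succ))
    -- the unit vector as fourth row removes the first column, giving minors of smaller size
    have hP := plucker_three_term (M.submatrix I J) hne (fun s => M (I p.castSucc) (J s))
      (fun s => M (I p.succ) (J s)) (fun s => M b (J s)) (Pi.single 0 1)
    have hrow : ∀ (K : Fin (n + 1) → Fin d) (q : Fin (n + 1)) (x : Fin d),
        (M.submatrix K J).updateRow q (fun s => M x (J s)) =
          M.submatrix (Function.update K q x) J := by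
      intro K q x
      ext i j
      simp only [Matrix.updateRow_apply, Matrix.submatrix_apply, Function.update_apply]
      split_ifs <;> rfl
    have u1 : Function.update I p.castSucc (I p.castSucc) = I := Function.update_eq_self _ _
    have u2 : Function.update I p.succ (I p.succ) = I := Function.update_eq_self _ _
    have u3 : Function.update (Function.update I p.castSucc b) p.succ (I p.succ)
        = Function.update I p.castSucc b := by
      rw [Function.update_comm hne, u2]
    simp only [hrow, u1, u2, u3, det_updateRow_single, Matrix.submatrix_submatrix,
      Fin.succAbove_zero] at hP
    have u4 : Function.update I p.castSucc (I p.succ) ∘ p.succ.succAbove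
        = I ∘ p.castSucc.succAbove := by
      funext q
      simp only [Function.comp, Function.update_apply]
      rcases lt_trichotomy q p with h | h | h
      · rw [Fin.succAbove_of_castSucc_lt _ _ (by simpa [Fin.lt_def] using Nat.lt_succ_of_lt h),
          Fin.succAbove_of_castSucc_lt _ _ (by simpa using h), if_neg (by simpa using h.ne)]
      · subst h
        simp
      · rw [Fin.succAbove_of_le_castSucc _ _ (by simpa [Fin.le_def] using h),
          Fin.succAbove_of_le_castSucc _ _ (by simpa using h.le),
          if_neg (by simp [Fin.ext_iff]; have : (p : ℕ) < q := h; omega)]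
    rw [u4] at hP
    set ε : ℝ := (-1) ^ ((p.succ : ℕ) + ((0 : Fin (n + 1)) : ℕ)) with hε
    have hε0 : ε ≠ 0 := by rw [hε]; exact pow_ne_zero _ (by norm_num)
    have hP' := mul_left_cancel₀ hε0 (b := (M.submatrix I J).det *
      (M.submatrix (Function.update I p.castSucc b ∘ p.succ.succAbove) (J ∘ Fin.succ)).det)
      (c := (M.submatrix (Function.update I p.castSucc b) J).det *
        (M.submatrix (I ∘ p.succ.succAbove) (J ∘ Fin.succ)).det +
        (M.submatrix (Function.update I p.succ b) J).det *
          (M.submatrix (I ∘ p.castSucc.succAbove) (J ∘ Fin.succ)).det) (by linarith [hP])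
    refine lt_of_le_of_ne (hN _ _ _ hI hJ) fun h0 => ?_
    rw [← h0, zero_mul] at hP'
    have := mul_pos hposlow hsmall
    have := mul_nonneg hN1 hN2
    linarith

/-- A totally nonnegative matrix whose contiguous minors above the diagonal are positive has all its
minors above the diagonal positive. The gaps of the columns are filled like those of the rows, after
a reflection of the matrix in its antidiagonal. -/
theorem minor_pos_of_contiguous {d : ℕ} {M : Matrix (Fin d) (Fin d) ℝ} (hN : IsTotallyNonneg M)
    (hpos : ∀ (k : ℕ) (I J : Fin k → Fin d), StrictMono I → StrictMono J → IsContiguous I →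
      IsContiguous J → (∀ p, I p ≤ J p) → 0 < (M.submatrix I J).det) :
    ∀ (k : ℕ) (I J : Fin k → Fin d), StrictMono I → StrictMono J → (∀ p, I p ≤ J p) →
      0 < (M.submatrix I J).det := by
  have h1 := minor_pos_of_contiguous_rows hN (fun k J => IsContiguous J)
    (fun k J h p q => by have := h p.succ q.succ; simp at this ⊢; omega)
    (fun k I J hI hJ cI cJ hIJ => hpos k I J hI hJ cI cJ hIJ)
  let M' : Matrix (Fin d) (Fin d) ℝ := Matrix.of fun i j => M j.rev i.rev
  have hflip : ∀ (k : ℕ) (I J : Fin k → Fin d), (M'.submatrix I J).det =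
      (M.submatrix (Fin.rev ∘ J ∘ Fin.rev) (Fin.rev ∘ I ∘ Fin.rev)).det := by
    intro k I J
    have : M.submatrix (Fin.rev ∘ J ∘ Fin.rev) (Fin.rev ∘ I ∘ Fin.rev) =
      ((M'.submatrix I J).submatrix Fin.revPerm Fin.revPerm).transpose := by
      ext i j; simp [M']
    rw [this, Matrix.det_transpose, Matrix.det_submatrix_equiv_self]
  have hrev : ∀ {k : ℕ} {I : Fin k → Fin d}, StrictMono I → StrictMono (Fin.rev ∘ I ∘ Fin.rev) :=
    fun h a b hab => Fin.rev_lt_rev.2 (h (Fin.rev_lt_rev.2 hab))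
  have h2 := minor_pos_of_contiguous_rows (M := M')
    (fun k I J hI hJ => by rw [hflip]; exact hN _ _ _ (hrev hJ) (hrev hI)) (fun k J => True)
    (fun _ _ _ => trivial)
    (fun k I J hI hJ cI _ hIJ => by
      rw [hflip]
      refine h1 _ _ _ (hrev hJ) (hrev hI) (fun p q => ?_) fun p => Fin.rev_le_rev.2 (hIJ _)
      have := cI p.rev q.rev
      have hp := p.2
      have hq := q.2
      have := (I p.rev).2
      have := (I q.rev).2
      simp only [Function.comp, Fin.val_rev] at *
      omega)
  intro k I J hI hJ hIJ
  have h3 := h2 k (Fin.rev ∘ J ∘ Fin.rev) (Fin.rev ∘ I ∘ Fin.rev) (hrev hJ) (hrev hI) trivial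
    fun p => Fin.rev_le_rev.2 (hIJ _)
  rw [hflip] at h3
  convert h3 using 3 <;> (funext p; simp)

/-! ### The totally positive unipotent matrices among the unipotent ones -/

/-- The minor of size `k` with rows `i, …, i + k - 1` and columns `j, …, j + k - 1`. Entries
outside the matrix are read as `0`. -/
noncomputable def contiguousMinor {d : ℕ} (M : Matrix (Fin d) (Fin d) ℝ) (i j k : ℕ) : ℝ :=
  (Matrix.of fun p q : Fin k =>
    if h : i + p < d ∧ j + q < d then M ⟨i + p, h.1⟩ ⟨j + q, h.2⟩ else 0).det

lemma contiguousMinor_eq {d : ℕ} (M : Matrix (Fin d) (Fin d) ℝ) {i j k : ℕ} (hi : i + k ≤ d)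
    (hj : j + k ≤ d) : contiguousMinor M i j k =
      (M.submatrix (fun p : Fin k => (⟨i + p, by omega⟩ : Fin d))
        (fun q : Fin k => (⟨j + q, by omega⟩ : Fin d))).det := by
  unfold contiguousMinor
  congr 1
  ext p q
  have hp := p.2
  have hq := q.2
  rw [Matrix.of_apply, dif_pos ⟨by omega, by omega⟩]
  rfl

lemma strictMono_shift {d i k : ℕ} (hi : i + k ≤ d) :
    StrictMono (fun p : Fin k => (⟨i + p, by omega⟩ : Fin d)) :=
  fun p q h => by
    have : (p : ℕ) < q := h
    simp only [Fin.lt_def]; omega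

lemma continuous_contiguousMinor {d : ℕ} (i j k : ℕ) :
    Continuous fun M : Matrix (Fin d) (Fin d) ℝ => contiguousMinor M i j k := by
  unfold contiguousMinor
  refine Continuous.matrix_det (continuous_matrix fun p q => ?_)
  simp only [Matrix.of_apply]
  split_ifs
  · fun_prop
  · fun_prop

lemma dodgson_contiguousMinor {d : ℕ} (M : Matrix (Fin d) (Fin d) ℝ) (i j k : ℕ) :
    contiguousMinor M i j (k + 2) * contiguousMinor M (i + 1) (j + 1) k =
      contiguousMinor M i j (k + 1) * contiguousMinor M (i + 1) (j + 1) (k + 1) -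
      contiguousMinor M i (j + 1) (k + 1) * contiguousMinor M (i + 1) j (k + 1) := by
  have h := desnanot_jacobi (Matrix.of fun p q : Fin (k + 2) =>
    if h : i + p < d ∧ j + q < d then M ⟨i + p, h.1⟩ ⟨j + q, h.2⟩ else 0)
  unfold contiguousMinor
  have e : ∀ i p : ℕ, i + 1 + p = i + (p + 1) := fun i p => by omega
  simp only [e]
  exact h

namespace IsTotallyPositiveUnipotent

variable {d : ℕ} {M : Matrix (Fin d) (Fin d) ℝ}

lemma minor_pos (hM : IsTotallyPositiveUnipotent M) {k : ℕ} {I J : Fin k → Fin d}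
    (hI : StrictMono I) (hJ : StrictMono J) (h : ∀ p, I p ≤ J p) : 0 < (M.submatrix I J).det :=
  hM.minors k (OrderEmbedding.ofStrictMono I hI) (OrderEmbedding.ofStrictMono J hJ) h

lemma isTotallyNonneg (hM : IsTotallyPositiveUnipotent M) : IsTotallyNonneg M := by
  intro k I J hI hJ
  by_cases h : ∀ p, I p ≤ J p
  · exact (hM.minor_pos hI hJ h).le
  · push Not at h
    obtain ⟨p, hp⟩ := h
    exact (det_submatrix_eq_zero_of_upper hM.upper hI.monotone hJ.monotone hp).ge

lemma contiguousMinor_pos (hM : IsTotallyPositiveUnipotent M) {i j k : ℕ} (hij : i ≤ j)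
    (hj : j + k ≤ d) : 0 < contiguousMinor M i j k := by
  rw [contiguousMinor_eq M (by omega) hj]
  exact hM.minor_pos (strictMono_shift (by omega)) (strictMono_shift (by omega)) fun p => by
    simpa [Fin.le_def] using hij

lemma contiguousMinor_nonneg (hM : IsTotallyPositiveUnipotent M) {i j k : ℕ} (hi : i + k ≤ d)
    (hj : j + k ≤ d) : 0 ≤ contiguousMinor M i j k := by
  rw [contiguousMinor_eq M hi hj]
  exact hM.isTotallyNonneg _ _ _ (strictMono_shift (by omega)) (strictMono_shift (by omega))

lemma contiguousMinor_mul_le (hM : IsTotallyPositiveUnipotent M) {i j k : ℕ} (hij : i ≤ j)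
    (hj : j + (k + 2) ≤ d) :
    contiguousMinor M i j (k + 2) * contiguousMinor M (i + 1) (j + 1) k ≤
      contiguousMinor M i j (k + 1) * contiguousMinor M (i + 1) (j + 1) (k + 1) := by
  rw [dodgson_contiguousMinor]
  have h1 := hM.contiguousMinor_nonneg (i := i) (j := j + 1) (k := k + 1) (by omega) (by omega)
  have h2 := hM.contiguousMinor_nonneg (i := i + 1) (j := j) (k := k + 1) (by omega) (by omega)
  linarith [mul_nonneg h1 h2]

/-- An inequality of Hadamard–Fischer type. Being closed, it persists for limits of totally positive
matrices, where it shows that the vanishing of a contiguous minor propagates to larger ones. -/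
lemma contiguousMinor_succ_le (hM : IsTotallyPositiveUnipotent M) {i j k : ℕ} (hij : i ≤ j)
    (hj : j + (k + 1) ≤ d) :
    contiguousMinor M i j (k + 1) ≤ contiguousMinor M i j k * contiguousMinor M (i + k) (j + k) 1 := by
  induction k generalizing i j with
  | zero => simp [contiguousMinor]
  | succ k ih =>
    have hint := hM.contiguousMinor_pos (i := i + 1) (j := j + 1) (k := k) (by omega) (by omega)
    have h1 := hM.contiguousMinor_mul_le hij (k := k) (by omega)
    have h2 := ih (i := i + 1) (j := j + 1) (by omega) (by omega)
    rw [show i + 1 + k = i + (k + 1) by omega, show j + 1 + k = j + (k + 1) by omega] at h2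
    have h3 := hM.contiguousMinor_pos (i := i) (j := j) (k := k + 1) (by omega) (by omega)
    refine le_of_mul_le_mul_right ?_ hint
    calc _ ≤ _ := h1
      _ ≤ _ := mul_le_mul_of_nonneg_left h2 h3.le
      _ = _ := by ring

lemma contiguousMinor_succ_le' (hM : IsTotallyPositiveUnipotent M) {i j k : ℕ} (hij : i ≤ j)
    (hj : j + (k + 1) ≤ d) :
    contiguousMinor M i j (k + 1) ≤ contiguousMinor M i j 1 * contiguousMinor M (i + 1) (j + 1) k := by
  induction k with
  | zero => simp [contiguousMinor]
  | succ k ih =>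
    have hint := hM.contiguousMinor_pos (i := i + 1) (j := j + 1) (k := k) (by omega) (by omega)
    have h1 := hM.contiguousMinor_mul_le hij (k := k) (by omega)
    have h2 := ih (by omega)
    have h3 := hM.contiguousMinor_pos (i := i + 1) (j := j + 1) (k := k + 1) (by omega) (by omega)
    refine le_of_mul_le_mul_right ?_ hint
    calc _ ≤ _ := h1
      _ ≤ _ := mul_le_mul_of_nonneg_right h2 h3.le
      _ = _ := by ring

/-- Conjugation by a positive diagonal matrix preserves total positivity. -/
lemma conj_diagonal (hM : IsTotallyPositiveUnipotent M) {l : Fin d → ℝ} (hl : ∀ i, 0 < l i) :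
    IsTotallyPositiveUnipotent (Matrix.of fun i j => l i * M i j * (l j)⁻¹) where
  upper i j h := by simp [hM.upper i j h]
  diag i := by simp [hM.diag i, (hl i).ne']
  minors k I J h := by
    have : (Matrix.of fun i j => l i * M i j * (l j)⁻¹).submatrix I J =
        Matrix.of fun p q => (l (J q))⁻¹ * (Matrix.of fun p q => l (I p) * M.submatrix I J p q) p q := by
      ext p q; simp; ring
    rw [this, Matrix.det_mul_row, Matrix.det_mul_column]
    have h1 : 0 < ∏ p, l (I p) := Finset.prod_pos fun p _ => hl _
    have h2 : 0 < ∏ p, (l (J p))⁻¹ := Finset.prod_pos fun p _ => inv_pos.2 (hl _)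
    have := hM.minors k I J h
    positivity

/-- Among upper triangular unipotent matrices, total positivity is an open condition. -/
lemma eventually (hM : IsTotallyPositiveUnipotent M) :
    ∀ᶠ M' : Matrix (Fin d) (Fin d) ℝ in 𝓝 M, (∀ i j, j < i → M' i j = 0) → (∀ i, M' i i = 1) →
      IsTotallyPositiveUnipotent M' := by
  have h : ∀ k ∈ Finset.range (d + 1), ∀ᶠ M' : Matrix (Fin d) (Fin d) ℝ in 𝓝 M,
      ∀ I J : Fin k ↪o Fin d, (∀ p, I p ≤ J p) → 0 < (M'.submatrix I J).det := by
    intro k _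
    rw [eventually_all]; intro I
    rw [eventually_all]; intro J
    by_cases hIJ : ∀ p, I p ≤ J p
    · have hc : Continuous fun M' : Matrix (Fin d) (Fin d) ℝ => (M'.submatrix I J).det := by
        fun_prop
      filter_upwards [hc.continuousAt.eventually_mem (Ioi_mem_nhds (hM.minors k I J hIJ))]
        with M' h' _ using h'
    · exact Eventually.of_forall fun M' h => absurd h hIJ
  filter_upwards [(Finset.eventually_all _).2 h] with M' h' hu hd
  refine ⟨hu, hd, fun k I J => h' k ?_ I J⟩
  have := Fintype.card_le_of_injective I I.injective
  simp at this ⊢; omega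

end IsTotallyPositiveUnipotent

/-- A limit of totally positive unipotent matrices whose upper right corner minors do not vanish is
totally positive. -/
theorem isTotallyPositiveUnipotent_of_mem_closure {d : ℕ} {M : Matrix (Fin d) (Fin d) ℝ}
    (hM : M ∈ closure {M' | IsTotallyPositiveUnipotent M'})
    (hc : ∀ k ≤ d, contiguousMinor M 0 (d - k) k ≠ 0) : IsTotallyPositiveUnipotent M := by
  have hcl : ∀ {s : Set (Matrix (Fin d) (Fin d) ℝ)}, IsClosed s →
      (∀ M', IsTotallyPositiveUnipotent M' → M' ∈ s) → M ∈ s :=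
    fun hs h => closure_minimal h hs hM
  have hle : ∀ f g : Matrix (Fin d) (Fin d) ℝ → ℝ, Continuous f → Continuous g →
      (∀ M', IsTotallyPositiveUnipotent M' → f M' ≤ g M') → f M ≤ g M :=
    fun f g hf hg h => hcl (isClosed_le hf hg) h
  have heq : ∀ f g : Matrix (Fin d) (Fin d) ℝ → ℝ, Continuous f → Continuous g →
      (∀ M', IsTotallyPositiveUnipotent M' → f M' = g M') → f M = g M :=
    fun f g hf hg h => hcl (isClosed_eq hf hg) h
  have hu : ∀ i j, j < i → M i j = 0 := fun i j hij =>
    heq (fun M => M i j) (fun _ => 0) (by fun_prop) (by fun_prop) fun M' h => h.upper i j hij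
  have hN : IsTotallyNonneg M := fun k I J hI hJ =>
    hle (fun _ => 0) (fun M => (M.submatrix I J).det) (by fun_prop) (by fun_prop)
      fun M' h => h.isTotallyNonneg k I J hI hJ
  have hnn : ∀ {i j k : ℕ}, i + k ≤ d → j + k ≤ d → 0 ≤ contiguousMinor M i j k := by
    intro i j k hi hj
    rw [contiguousMinor_eq M hi hj]
    exact hN _ _ _ (strictMono_shift (by omega)) (strictMono_shift (by omega))
  have chop : ∀ {i j k : ℕ}, i ≤ j → j + (k + 1) ≤ d → 0 < contiguousMinor M i j (k + 1) →
      0 < contiguousMinor M i j k := by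
    intro i j k hij hj h
    refine lt_of_le_of_ne (hnn (by omega) (by omega)) fun h0 => ?_
    have := hle _ (fun M => contiguousMinor M i j k * contiguousMinor M (i + k) (j + k) 1)
      (continuous_contiguousMinor i j (k + 1))
      ((continuous_contiguousMinor _ _ _).mul (continuous_contiguousMinor _ _ _))
      fun M' h => h.contiguousMinor_succ_le hij hj
    simp only [← h0, zero_mul] at this
    linarith
  have chop' : ∀ {i j k : ℕ}, i ≤ j → j + (k + 1) ≤ d → 0 < contiguousMinor M i j (k + 1) →
      0 < contiguousMinor M (i + 1) (j + 1) k := by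
    intro i j k hij hj h
    refine lt_of_le_of_ne (hnn (by omega) (by omega)) fun h0 => ?_
    have := hle _ (fun M => contiguousMinor M i j 1 * contiguousMinor M (i + 1) (j + 1) k)
      (continuous_contiguousMinor i j (k + 1))
      ((continuous_contiguousMinor _ _ _).mul (continuous_contiguousMinor _ _ _))
      fun M' h => h.contiguousMinor_succ_le' hij hj
    simp only [← h0, mul_zero] at this
    linarith
  -- minors starting in the first row are obtained from the corner minors by chopping off the end
  have hfirst : ∀ c r j : ℕ, j + (r + c) = d → 0 < contiguousMinor M 0 j r := by
    intro c
    induction c with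
    | zero =>
      intro r j h
      refine lt_of_le_of_ne (hnn (by omega) (by omega)) fun h0 => hc r (by omega) ?_
      rw [show d - r = j by omega, ← h0]
    | succ c ih => exact fun r j h => chop (by omega) (by omega) (ih (r + 1) j (by omega))
  -- the other contiguous minors are obtained from these by chopping off the beginning
  have hcont : ∀ i j k : ℕ, i ≤ j → j + k ≤ d → 0 < contiguousMinor M i j k := by
    intro i
    induction i with
    | zero => exact fun j k _ h => hfirst (d - (j + k)) k j (by omega)
    | succ i ih =>
      intro j k hij hj
      obtain ⟨j, rfl⟩ : ∃ j', j = j' + 1 := ⟨j - 1, by omega⟩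
      exact chop' (by omega) (by omega) (ih j (k + 1) (by omega) (by omega))
  have key := minor_pos_of_contiguous hN fun k I J hI hJ cI cJ hIJ => by
    cases k with
    | zero => simp
    | succ k =>
      have hl1 := cI (Fin.last k) 0
      have hl2 := cJ (Fin.last k) 0
      have := (I (Fin.last k)).2
      have := (J (Fin.last k)).2
      simp only [Fin.val_last, Fin.val_zero, add_zero] at hl1 hl2
      have h := hcont (I 0) (J 0) (k + 1) (hIJ 0) (by omega)
      rw [contiguousMinor_eq M (by omega) (by omega)] at h
      convert h using 3
      · funext p; ext; simpa using cI p 0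
      · funext p; ext; simpa using cJ p 0
  exact ⟨hu, fun i => heq (fun M => M i i) (fun _ => 1) (by fun_prop) (by fun_prop)
    fun M' h => h.diag i, fun k I J h => key k I J I.strictMono J.strictMono h⟩

/-! ### Powers of a unipotent matrix with a single Jordan block -/

/-- The entries `1 / (j - i)!` of the exponential of the nilpotent Jordan block. -/
noncomputable def expJordan (i j : ℕ) : ℝ := if i ≤ j then ((j - i).factorial : ℝ)⁻¹ else 0

lemma sub_mul_expJordan (i j : ℕ) : ((j : ℝ) - i) * expJordan i j = expJordan (i + 1) j := by
  unfold expJordan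
  rcases lt_trichotomy i j with h | h | h
  · rw [if_pos h.le, if_pos (Nat.succ_le_of_lt h)]
    obtain ⟨r, rfl⟩ : ∃ r, j = i + 1 + r := ⟨j - (i + 1), by omega⟩
    rw [show i + 1 + r - i = r + 1 by omega, show i + 1 + r - (i + 1) = r by omega,
      Nat.factorial_succ]
    push_cast
    field_simp
    ring
  · subst h; simp
  · rw [if_neg (by omega), if_neg (by omega), mul_zero]

/-- Summing over the rows the determinants in which an entry `A a b` of the row `a` is multiplied
by `y b - x a`; this is the derivative of `det A` under rescaling of rows and columns. -/
lemma sum_det_updateRow_sub_mul {n : Type*} [Fintype n] [DecidableEq n] (A : Matrix n n ℝ)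
    (x y : n → ℝ) :
    ∑ a, (A.updateRow a fun b => (y b - x a) * A a b).det = (∑ b, y b - ∑ a, x a) * A.det := by
  have h : ∀ a, (A.updateRow a fun b => (y b - x a) * A a b).det =
      ∑ b, y b * (A.adjugate b a * A a b) - x a * ∑ b, A a b * A.adjugate b a := by
    intro a
    rw [← Matrix.cramer_transpose_apply, Matrix.cramer_eq_adjugate_mulVec,
      ← Matrix.adjugate_transpose, Matrix.mulVec, dotProduct, Finset.mul_sum,
      ← Finset.sum_sub_distrib]
    exact Finset.sum_congr rfl fun b _ => by simp only [Matrix.transpose_apply]; ring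
  have h1 : ∀ a, ∑ b, A a b * A.adjugate b a = A.det := fun a => by
    rw [← Matrix.mul_apply, Matrix.mul_adjugate]; simp
  have h2 : ∀ b, ∑ a, A.adjugate b a * A a b = A.det := fun b => by
    rw [← Matrix.mul_apply, Matrix.adjugate_mul]; simp
  simp only [h, h1]
  rw [Finset.sum_sub_distrib, Finset.sum_comm]
  simp only [← Finset.mul_sum, h2]
  rw [← Finset.sum_mul, ← Finset.sum_mul]; ring

lemma det_expJordan_eq_zero {k : ℕ} {I J : Fin k → ℕ} (hI : Monotone I) (hJ : Monotone J)
    {p : Fin k} (hp : J p < I p) : (Matrix.of fun a b => expJordan (I a) (J b)).det = 0 :=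
  det_submatrix_eq_zero_of_upper (M := Matrix.of expJordan)
    (fun i j h => by simp [expJordan, h]) hI hJ hp

/-- The minors of the exponential of the nilpotent Jordan block. The weighted sum above expresses
`∑ (J - I)` times the minor `(I, J)` as the sum of the minors in which one row index is raised
by `1`; these vanish or are again of the same form. -/
lemma det_expJordan_pos {k : ℕ} {I J : Fin k → ℕ} (hI : StrictMono I) (hJ : StrictMono J)
    (h : ∀ p, I p ≤ J p) : 0 < (Matrix.of fun a b => expJordan (I a) (J b)).det := by
  induction hn : ∑ p, (J p - I p) generalizing I with
  | zero =>
    have hIJ : I = J := by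
      funext p
      have := (Finset.sum_eq_zero_iff.1 hn) p (Finset.mem_univ _)
      have := h p
      omega
    subst hIJ
    rw [Matrix.det_of_isUpperTriangular]
    · simp [expJordan]
    · intro a b hab
      have : I b < I a := hI hab
      simp [expJordan, not_le.2 this]
  | succ n ih =>
    set A : Matrix (Fin k) (Fin k) ℝ := Matrix.of fun a b => expJordan (I a) (J b) with hA
    have hup : ∀ a, (A.updateRow a fun b => ((J b : ℝ) - I a) * A a b) =
        Matrix.of fun c b => expJordan (Function.update I a (I a + 1) c) (J b) := by
      intro a
      ext c b
      simp only [Matrix.updateRow_apply, Matrix.of_apply, Function.update_apply, hA,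
        sub_mul_expJordan]
      split_ifs <;> rfl
    have hle : ∀ a, I a < J a → ∀ p, Function.update I a (I a + 1) p ≤ J p := by
      intro a ha p
      by_cases hp : p = a
      · subst hp; simpa using ha
      · simpa [hp] using h p
    have hsum : ∀ a, I a < J a → ∑ p, (J p - Function.update I a (I a + 1) p) = n := by
      intro a ha
      have h1 := Finset.add_sum_erase Finset.univ (fun p => J p - I p) (Finset.mem_univ a)
      have h2 := Finset.add_sum_erase Finset.univ
        (fun p => J p - Function.update I a (I a + 1) p) (Finset.mem_univ a)
      have h3 : ∑ p ∈ Finset.univ.erase a, (J p - Function.update I a (I a + 1) p) =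
          ∑ p ∈ Finset.univ.erase a, (J p - I p) :=
        Finset.sum_congr rfl fun p hp => by rw [Function.update_of_ne (Finset.ne_of_mem_erase hp)]
      simp only [Function.update_self] at h2
      omega
    have hnonneg : ∀ a,
        0 ≤ (Matrix.of fun c b => expJordan (Function.update I a (I a + 1) c) (J b)).det := by
      intro a
      by_cases hm : StrictMono (Function.update I a (I a + 1))
      · by_cases ha : I a < J a
        · exact (ih hm (hle a ha) (hsum a ha)).le
        · refine (det_expJordan_eq_zero hm.monotone hJ.monotone (p := a) ?_).ge
          simp; omega
      · -- raising `I a` produces two equal rows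
        obtain ⟨c, hc, hca⟩ : ∃ c, c ≠ a ∧ I c = I a + 1 := by
          by_contra! hcon
          refine hm fun p q hpq => ?_
          have := hI hpq
          simp only [Function.update_apply]
          split_ifs with h1 h2 h2
          · exact absurd (h1.trans h2.symm) hpq.ne
          · subst h1; have := hcon q h2; omega
          · subst h2; omega
          · exact this
        refine (Matrix.det_zero_of_row_eq hc.symm ?_).ge
        funext b
        simp [hc, hca]
    -- at least one summand is positive: raise the last index that is still below its bound
    obtain ⟨a, ha, hmax⟩ : ∃ a, I a < J a ∧ ∀ q, a < q → I q = J q := by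
      have hne : (Finset.univ.filter fun a => I a < J a).Nonempty := by
        by_contra hcon
        rw [Finset.not_nonempty_iff_eq_empty, Finset.filter_eq_empty_iff] at hcon
        have : ∑ p, (J p - I p) = 0 := Finset.sum_eq_zero fun p hp => by
          have := hcon hp; omega
        omega
      refine ⟨_, (Finset.mem_filter.1 (Finset.max'_mem _ hne)).2, fun q hq => ?_⟩
      by_contra hcon
      have := Finset.le_max' (Finset.univ.filter fun a => I a < J a) q
        (Finset.mem_filter.2 ⟨Finset.mem_univ _, lt_of_le_of_ne (h q) hcon⟩)
      exact absurd hq (not_lt.2 this)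
    have hm : StrictMono (Function.update I a (I a + 1)) := by
      intro p q hpq
      have := hI hpq
      simp only [Function.update_apply]
      split_ifs with h1 h2 h2
      · exact absurd (h1.trans h2.symm) hpq.ne
      · subst h1; rw [hmax q hpq]; have := hJ hpq; omega
      · subst h2; omega
      · exact this
    have hpos := ih hm (hle a ha) (hsum a ha)
    have key := sum_det_updateRow_sub_mul A (fun a => (I a : ℝ)) (fun b => (J b : ℝ))
    simp only [hup] at key
    have hl : 0 < ∑ a, (Matrix.of fun c b => expJordan (Function.update I a (I a + 1) c) (J b)).det :=
      Finset.sum_pos' (fun a _ => hnonneg a) ⟨a, Finset.mem_univ _, hpos⟩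
    rw [key] at hl
    refine (pos_iff_pos_of_mul_pos hl).1 ?_
    rw [sub_pos]
    exact_mod_cast Finset.sum_lt_sum (fun p _ => h p) ⟨a, Finset.mem_univ _, ha⟩

lemma isTotallyPositiveUnipotent_expJordan (d : ℕ) :
    IsTotallyPositiveUnipotent (Matrix.of fun i j : Fin d => expJordan i j) where
  upper i j h := by simp [expJordan, not_le.2 h]
  diag i := by simp [expJordan]
  minors k I J h := det_expJordan_pos (I := fun p => (I p : ℕ)) (J := fun p => (J p : ℕ))
    (fun p q hpq => I.strictMono hpq) (fun p q hpq => J.strictMono hpq) h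

lemma one_add_pow_eq_sum {A : Type*} [Ring A] {N : A} {d : ℕ} (hN : N ^ d = 0) (n : ℕ) :
    (1 + N) ^ n = ∑ m ∈ Finset.range d, n.choose m • N ^ m := by
  have h1 : (1 + N) ^ n = ∑ m ∈ Finset.range (n + 1), n.choose m • N ^ m := by
    rw [add_comm, (Commute.one_right N).add_pow]
    refine Finset.sum_congr rfl fun m _ => ?_
    rw [one_pow, mul_one, nsmul_eq_mul, Nat.cast_comm]
  have h2 : ∀ a b : ℕ, n + 1 ≤ b → d ≤ b → a = n + 1 ∨ a = d →
      ∑ m ∈ Finset.range a, n.choose m • N ^ m = ∑ m ∈ Finset.range b, n.choose m • N ^ m := by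
    intro a b hb hb' ha
    refine Finset.sum_subset (by simp; omega) fun m _ hm => ?_
    simp only [Finset.mem_range, not_lt] at hm
    rcases ha with rfl | rfl
    · rw [Nat.choose_eq_zero_of_lt (by omega), zero_smul]
    · rw [← Nat.sub_add_cancel hm, pow_add, hN, mul_zero, smul_zero]
  rw [h1, h2 _ (max (n + 1) d) (le_max_left _ _) (le_max_right _ _) (Or.inl rfl),
    h2 d (max (n + 1) d) (le_max_left _ _) (le_max_right _ _) (Or.inr rfl)]

lemma tendsto_choose_div_pow (m : ℕ) :
    Tendsto (fun n : ℕ => (n.choose m : ℝ) / (n : ℝ) ^ m) atTop (𝓝 (m.factorial : ℝ)⁻¹) := by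
  induction m with
  | zero => simp
  | succ m ih =>
    have h1 : Tendsto (fun n : ℕ => (1 - (m : ℝ) / n) / (m + 1)) atTop (𝓝 ((1 - 0) / (m + 1))) :=
      (tendsto_const_nhds.sub (tendsto_const_div_atTop_nhds_zero_nat _)).div_const _
    have h2 := ih.mul h1
    rw [Nat.factorial_succ]
    have e : ((m.factorial : ℝ))⁻¹ * ((1 - 0) / (m + 1)) = (((m + 1) * m.factorial : ℕ) : ℝ)⁻¹ := by
      push_cast; field_simp; ring
    rw [e] at h2
    refine h2.congr' ?_
    filter_upwards [eventually_gt_atTop m] with n hn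
    have hc : (n.choose (m + 1) : ℝ) * (m + 1) = n.choose m * (n - m) := by
      have := Nat.choose_succ_right_eq n m
      have h3 : ((n - m : ℕ) : ℝ) = n - m := Nat.cast_sub hn.le
      rw [← h3]; exact_mod_cast this
    have hn0 : (n : ℝ) ≠ 0 := Nat.cast_ne_zero.2 (by omega)
    have hm0 : (m + 1 : ℝ) ≠ 0 := by positivity
    rw [eq_div_iff_mul_eq hm0 |>.2 hc]
    field_simp
    ring

lemma tendsto_choose_div_pow_of_lt {m r : ℕ} (h : m < r) :
    Tendsto (fun n : ℕ => (n.choose m : ℝ) / (n : ℝ) ^ r) atTop (𝓝 0) := by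
  have h1 : Tendsto (fun n : ℕ => ((n : ℝ) ^ (r - m))⁻¹) atTop (𝓝 0) :=
    ((tendsto_pow_atTop (by omega)).comp tendsto_natCast_atTop_atTop).inv_tendsto_atTop
  have h2 := (tendsto_choose_div_pow m).mul h1
  rw [mul_zero] at h2
  refine h2.congr fun n => ?_
  rw [div_mul_eq_mul_div, ← div_eq_mul_inv, div_div, ← pow_add, show r - m + m = r by omega]

lemma pow_apply_of_strictUpper {d : ℕ} {N : Matrix (Fin d) (Fin d) ℝ}
    (hN : ∀ i j, j ≤ i → N i j = 0) (m : ℕ) :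
    ∀ i j : Fin d, (j : ℕ) < i + m → (N ^ m) i j = 0 := by
  induction m with
  | zero =>
    intro i j h
    have : i ≠ j := by rintro rfl; omega
    simp [this]
  | succ m ih =>
    intro i j h
    rw [pow_succ, Matrix.mul_apply]
    refine Finset.sum_eq_zero fun l _ => ?_
    by_cases hl : (l : ℕ) < i + m
    · rw [ih i l hl, zero_mul]
    · rw [hN l j (by rw [Fin.le_def]; omega), mul_zero]

/-- The entries of `N ^ m` on the `m`-th superdiagonal, for `N` strictly upper triangular. -/
lemma pow_apply_superdiagonal {d : ℕ} {N : Matrix (Fin d) (Fin d) ℝ}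
    (hN : ∀ i j, j ≤ i → N i j = 0) (m : ℕ) :
    ∀ i j : Fin d, (j : ℕ) = i + m → (N ^ m) i j =
      ∏ l ∈ Finset.range m, if h : i + l + 1 < d then N ⟨i + l, by omega⟩ ⟨i + l + 1, h⟩ else 0 := by
  induction m with
  | zero =>
    intro i j h
    have : i = j := by ext; omega
    simp [this]
  | succ m ih =>
    intro i j h
    have hd := j.2
    rw [pow_succ, Matrix.mul_apply, Finset.prod_range_succ, dif_pos (by omega),
      Finset.sum_eq_single ⟨i + m, by omega⟩, ih i _ rfl]
    · congr 2; ext; simp; omega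
    · intro l _ hl
      have hl' : (l : ℕ) ≠ i + m := fun h' => hl (by ext; exact h')
      by_cases hl2 : (l : ℕ) < i + m
      · rw [pow_apply_of_strictUpper hN m i l hl2, zero_mul]
      · rw [hN l j (by rw [Fin.le_def]; omega), mul_zero]
    · simp

/-- Large powers of an upper triangular unipotent matrix with ones on the superdiagonal are totally
positive: rescaling by `diag(1, n⁻¹, n⁻², …)`, the `n`-th power converges to the exponential of
the nilpotent Jordan block. -/
theorem eventually_isTotallyPositiveUnipotent_pow {d : ℕ} {N : Matrix (Fin d) (Fin d) ℝ}
    (hN : ∀ i j, j ≤ i → N i j = 0) (hN1 : ∀ i j : Fin d, (j : ℕ) = i + 1 → N i j = 1) :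
    ∀ᶠ n : ℕ in atTop, IsTotallyPositiveUnipotent ((1 + N) ^ n) := by
  have hNd : N ^ d = 0 := by
    ext i j; exact pow_apply_of_strictUpper hN d i j (by omega)
  have hentry : ∀ (n : ℕ) (i j : Fin d), ((1 + N) ^ n) i j =
      ∑ m ∈ Finset.range d, (n.choose m : ℝ) * (N ^ m) i j := by
    intro n i j
    rw [one_add_pow_eq_sum hNd, Matrix.sum_apply]
    simp
  have hup : ∀ (n : ℕ) (i j : Fin d), j < i → ((1 + N) ^ n) i j = 0 := fun n i j h => by
    rw [hentry]
    refine Finset.sum_eq_zero fun m _ => ?_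
    rw [pow_apply_of_strictUpper hN m i j (by have : (j : ℕ) < i := h; omega), mul_zero]
  have hdiag : ∀ (n : ℕ) (i : Fin d), ((1 + N) ^ n) i i = 1 := fun n i => by
    rw [hentry, Finset.sum_eq_single 0]
    · simp
    · intro m _ hm
      rw [pow_apply_of_strictUpper hN m i i (by omega), mul_zero]
    · have := i.2; simp; omega
  have hlim : Tendsto (fun n : ℕ => Matrix.of fun i j : Fin d =>
      (n : ℝ) ^ (i : ℕ) * ((1 + N) ^ n) i j * ((n : ℝ) ^ (j : ℕ))⁻¹) atTop
      (𝓝 (Matrix.of fun i j : Fin d => expJordan i j)) := by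
    refine tendsto_pi_nhds.2 fun i => tendsto_pi_nhds.2 fun j => ?_
    simp only [Matrix.of_apply]
    by_cases hij : (i : ℕ) ≤ j
    · obtain ⟨r, hr⟩ : ∃ r, (j : ℕ) = i + r := ⟨j - i, by omega⟩
      have hone : (N ^ r) i j = 1 := by
        rw [pow_apply_superdiagonal hN r i j hr]
        refine Finset.prod_eq_one fun l hl => ?_
        rw [Finset.mem_range] at hl
        rw [dif_pos (by omega)]
        exact hN1 _ _ rfl
      have h1 : Tendsto (fun n : ℕ => ∑ m ∈ Finset.range d,
          (n.choose m : ℝ) / (n : ℝ) ^ r * (N ^ m) i j) atTop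
          (𝓝 (∑ m ∈ Finset.range d, if m = r then (r.factorial : ℝ)⁻¹ else 0)) := by
        refine tendsto_finsetSum _ fun m _ => ?_
        rcases lt_trichotomy m r with h | h | h
        · rw [if_neg h.ne]
          simpa using (tendsto_choose_div_pow_of_lt h).mul_const ((N ^ m) i j)
        · subst h
          simpa [hone] using tendsto_choose_div_pow m
        · rw [if_neg h.ne', pow_apply_of_strictUpper hN m i j (by omega)]
          simp
      have h2 : expJordan i j = ∑ m ∈ Finset.range d, if m = r then (r.factorial : ℝ)⁻¹ else 0 := by
        have := j.2
        rw [Finset.sum_ite_eq', if_pos (by simp; omega), expJordan, if_pos hij, hr,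
          Nat.add_sub_cancel_left]
      rw [h2]
      refine h1.congr' ?_
      filter_upwards [eventually_gt_atTop 0] with n hn
      have hn0 : (n : ℝ) ≠ 0 := by positivity
      rw [hentry, hr, Finset.mul_sum, Finset.sum_mul]
      refine Finset.sum_congr rfl fun m _ => ?_
      rw [pow_add]
      field_simp
    · have : expJordan i j = 0 := by simp [expJordan, hij]
      rw [this]
      refine tendsto_const_nhds.congr fun n => ?_
      rw [hup n i j (by rw [Fin.lt_def]; omega)]; simp
  have hev := hlim.eventually (isTotallyPositiveUnipotent_expJordan d).eventually
  filter_upwards [hev, eventually_gt_atTop 0] with n h hn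
  have hn0 : (n : ℝ) ≠ 0 := by positivity
  have h1 := h (fun i j hij => by simp [hup n i j hij])
    (fun i => by simp [hdiag n i, hn0])
  have h2 := h1.conj_diagonal (l := fun i => ((n : ℝ) ^ (i : ℕ))⁻¹) (fun i => by positivity)
  convert h2 using 1
  ext i j
  simp only [Matrix.of_apply]
  field_simp

/-! ### Flags, frames and transversality -/

variable {d : ℕ}

lemma mk_smul_flag (g : GL (Fin d) ℝ) (F : CompleteFlag d) :
    (Matrix.ProjGenLinGroup.mk g : PGL(Fin d, ℝ)) • F = g • F := rfl

lemma glEquiv_mul (g h : GL (Fin d) ℝ) (v : Fin d → ℝ) :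
    glEquiv (g * h) v = glEquiv g (glEquiv h v) := by
  simp [glEquiv_apply]

@[simp] lemma glEquiv_one (v : Fin d → ℝ) : glEquiv 1 v = v := by simp [glEquiv_apply]

@[simp] lemma glEquiv_inv_apply (g : GL (Fin d) ℝ) (v : Fin d → ℝ) :
    glEquiv g⁻¹ (glEquiv g v) = v := by
  rw [← glEquiv_mul, inv_mul_cancel, glEquiv_one]

@[simp] lemma glEquiv_apply_inv (g : GL (Fin d) ℝ) (v : Fin d → ℝ) :
    glEquiv g (glEquiv g⁻¹ v) = v := by
  rw [← glEquiv_mul, mul_inv_cancel, glEquiv_one]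

lemma mem_sub_smul {g : GL (Fin d) ℝ} {F : CompleteFlag d} {k : Fin (d + 1)} {v : Fin d → ℝ} :
    v ∈ (g • F).sub k ↔ glEquiv g⁻¹ v ∈ F.sub k := by
  rw [sub_smul, Submodule.mem_map]
  constructor
  · rintro ⟨w, hw, rfl⟩
    simpa using hw
  · intro h
    exact ⟨_, h, by simp⟩

lemma CompleteFlag.eq_of_le {F G : CompleteFlag d} (h : ∀ k, F.sub k ≤ G.sub k) : F = G :=
  CompleteFlag.ext (funext fun k => Submodule.eq_of_le_of_finrank_eq (h k)
    (by rw [F.finrank_sub, G.finrank_sub]))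

lemma mem_standardFlag {k : Fin (d + 1)} {v : Fin d → ℝ} :
    v ∈ (standardFlag d).sub k ↔ ∀ i : Fin d, (k : ℕ) ≤ i → v i = 0 := by
  change v ∈ Submodule.span ℝ (Pi.basisFun ℝ (Fin d) '' {j | (j : ℕ) < k}) ↔ _
  rw [Module.Basis.mem_span_image]
  simp only [Set.subset_def, SetLike.mem_coe, Finsupp.mem_support_iff, Pi.basisFun_repr,
    Set.mem_ofPred_eq]
  exact forall_congr' fun i => ⟨fun h hi => by by_contra h0; exact absurd (h h0) (by omega),
    fun h h0 => by by_contra hi; exact h0 (h (by omega))⟩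

/-- The permutation matrix that reverses the standard basis. -/
noncomputable def reversal (d : ℕ) : GL (Fin d) ℝ where
  val := Fin.revPerm.permMatrix ℝ
  inv := Fin.revPerm.permMatrix ℝ
  val_inv := by
    rw [← Matrix.permMatrix_mul]
    have : (Fin.revPerm * Fin.revPerm : Equiv.Perm (Fin d)) = 1 := by ext; simp
    rw [this, Matrix.permMatrix_one]
  inv_val := by
    rw [← Matrix.permMatrix_mul]
    have : (Fin.revPerm * Fin.revPerm : Equiv.Perm (Fin d)) = 1 := by ext; simp
    rw [this, Matrix.permMatrix_one]

lemma glEquiv_reversal (v : Fin d → ℝ) (i : Fin d) : glEquiv (reversal d) v i = v i.rev := by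
  rw [glEquiv_apply]
  simp [reversal, Matrix.permMatrix_mulVec]

lemma reversal_inv : (reversal d)⁻¹ = reversal d := Units.ext rfl

/-- The flag opposite to the standard one: `Fᵏ` is spanned by the last `k` vectors of the
standard basis. -/
noncomputable def oppositeFlag (d : ℕ) : CompleteFlag d := reversal d • standardFlag d

lemma mem_oppositeFlag {k : Fin (d + 1)} {v : Fin d → ℝ} :
    v ∈ (oppositeFlag d).sub k ↔ ∀ i : Fin d, (i : ℕ) + k < d → v i = 0 := by
  rw [oppositeFlag, mem_sub_smul, reversal_inv, mem_standardFlag]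
  simp only [glEquiv_reversal]
  constructor
  · intro h i hi
    simpa using h i.rev (by simp; omega)
  · intro h i hi
    refine h _ ?_
    have := i.2
    simp; omega

lemma smul_standardFlag_of_upper {g : GL (Fin d) ℝ} (hg : ∀ i j : Fin d, j < i → g i j = 0) :
    g • standardFlag d = standardFlag d := by
  refine CompleteFlag.eq_of_le fun k => ?_
  rw [sub_smul, Submodule.map_le_iff_le_comap]
  intro v hv
  rw [mem_standardFlag] at hv
  rw [Submodule.mem_comap, mem_standardFlag]
  intro i hi
  rw [LinearEquiv.coe_coe, glEquiv_apply, Matrix.mulVec, dotProduct]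
  refine Finset.sum_eq_zero fun j _ => ?_
  by_cases hj : (k : ℕ) ≤ j
  · rw [hv j hj, mul_zero]
  · rw [hg i j (by rw [Fin.lt_def]; omega), zero_mul]

lemma smul_oppositeFlag_of_lower {g : GL (Fin d) ℝ} (hg : ∀ i j : Fin d, i < j → g i j = 0) :
    g • oppositeFlag d = oppositeFlag d := by
  refine CompleteFlag.eq_of_le fun k => ?_
  rw [sub_smul, Submodule.map_le_iff_le_comap]
  intro v hv
  rw [mem_oppositeFlag] at hv
  rw [Submodule.mem_comap, mem_oppositeFlag]
  intro i hi
  rw [LinearEquiv.coe_coe, glEquiv_apply, Matrix.mulVec, dotProduct]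
  refine Finset.sum_eq_zero fun j _ => ?_
  by_cases hj : (j : ℕ) + k < d
  · rw [hv j hj, mul_zero]
  · rw [hg i j (by rw [Fin.lt_def]; omega), zero_mul]

/-- Upper triangular matrices with unit diagonal. -/
def upperUnipotent (d : ℕ) : Subgroup (GL (Fin d) ℝ) where
  carrier := {g | (∀ i j : Fin d, j < i → g i j = 0) ∧ ∀ i, g i i = 1}
  one_mem' := ⟨fun i j h => by simp [h.ne'], fun i => by simp⟩
  mul_mem' := by
    rintro g h ⟨hg, hg1⟩ ⟨hh, hh1⟩
    constructor
    · intro i j hij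
      rw [Units.val_mul, Matrix.mul_apply]
      refine Finset.sum_eq_zero fun l _ => ?_
      by_cases hl : l < i
      · rw [hg i l hl, zero_mul]
      · rw [hh l j (lt_of_lt_of_le hij (not_lt.1 hl)), mul_zero]
    · intro i
      rw [Units.val_mul, Matrix.mul_apply, Finset.sum_eq_single i, hg1, hh1, mul_one]
      · intro l _ hl
        rcases lt_or_gt_of_ne hl with h' | h'
        · rw [hg i l h', zero_mul]
        · rw [hh l i h', mul_zero]
      · simp
  inv_mem' := by
    rintro g ⟨hg, hg1⟩
    have hu : ∀ i j : Fin d, j < i → (g⁻¹ : GL (Fin d) ℝ) i j = 0 := by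
      intro i j hij
      have : Invertible (g : Matrix (Fin d) (Fin d) ℝ) := g.isUnit.invertible
      have := Matrix.blockTriangular_inv_of_blockTriangular
        (M := (g : Matrix (Fin d) (Fin d) ℝ)) (b := id) (fun i j h => hg i j h)
      rw [Matrix.coe_units_inv]
      exact this hij
    refine ⟨hu, fun i => ?_⟩
    have h1 : (g * g⁻¹ : GL (Fin d) ℝ) i i = 1 := by rw [mul_inv_cancel]; simp
    rw [Units.val_mul, Matrix.mul_apply, Finset.sum_eq_single i, hg1, one_mul] at h1
    · exact h1
    · intro l _ hl
      rcases lt_or_gt_of_ne hl with h' | h'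
      · rw [hg i l h', zero_mul]
      · rw [hu l i h', mul_zero]
    · simp

lemma diag_mul_of_upper {A B : Matrix (Fin d) (Fin d) ℝ} (hA : ∀ i j, j < i → A i j = 0)
    (hB : ∀ i j, j < i → B i j = 0) (i : Fin d) : (A * B) i i = A i i * B i i := by
  rw [Matrix.mul_apply, Finset.sum_eq_single i]
  · intro l _ hl
    rcases lt_or_gt_of_ne hl with h' | h'
    · rw [hA i l h', zero_mul]
    · rw [hB l i h', mul_zero]
  · simp

/-- Upper unipotent matrices act freely on the opposite flag. -/
lemma eq_of_smul_oppositeFlag_eq {g h : GL (Fin d) ℝ} (hg : g ∈ upperUnipotent d)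
    (hh : h ∈ upperUnipotent d) (e : g • oppositeFlag d = h • oppositeFlag d) : g = h := by
  have hm : h⁻¹ * g ∈ upperUnipotent d := mul_mem (inv_mem hh) hg
  have e' : (h⁻¹ * g) • oppositeFlag d = oppositeFlag d := by
    rw [mul_smul, e, inv_smul_smul]
  have : h⁻¹ * g = 1 := by
    rw [Matrix.GeneralLinearGroup.ext_iff]
    intro i j
    rcases lt_trichotomy i j with hij | rfl | hij
    · -- the image of the `j`-th basis vector lies in the span of the last `d - j` ones
      have h1 : glEquiv (h⁻¹ * g) (Pi.single j 1) ∈ (oppositeFlag d).sub j.castSucc.rev := by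
        rw [← e', mem_sub_smul, glEquiv_inv_apply, mem_oppositeFlag]
        intro l hl
        have : l ≠ j := by rintro rfl; simp at hl
        simp [this]
      rw [mem_oppositeFlag] at h1
      have h2 := h1 i (by have : (i : ℕ) < j := hij; simp; omega)
      rw [glEquiv_apply, Matrix.mulVec_single_one] at h2
      simpa [hij.ne] using h2
    · simpa using hm.2 i
    · simpa [hij.ne'] using hm.1 i j hij
  exact (inv_mul_eq_one.1 this).symm

namespace CompleteFlag

lemma Transverse.disjoint {F G : CompleteFlag d} (h : F.Transverse G) (k : Fin (d + 1)) :
    F.sub k ⊓ G.sub k.rev = ⊥ := by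
  have h1 := Submodule.finrank_sup_add_finrank_inf_eq (F.sub k) (G.sub k.rev)
  rw [h k, finrank_top, F.finrank_sub, G.finrank_sub, Module.finrank_fin_fun] at h1
  have := k.2
  refine Submodule.finrank_eq_zero.1 ?_
  simp at h1; omega

lemma Transverse.eq_zero {F G : CompleteFlag d} (h : F.Transverse G) (k : Fin (d + 1))
    {v : Fin d → ℝ} (hF : v ∈ F.sub k) (hG : v ∈ G.sub k.rev) : v = 0 := by
  have : v ∈ F.sub k ⊓ G.sub k.rev := ⟨hF, hG⟩
  rwa [h.disjoint, Submodule.mem_bot] at this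

lemma Transverse.smul {F G : CompleteFlag d} (h : F.Transverse G) (g : GL (Fin d) ℝ) :
    (g • F).Transverse (g • G) := by
  intro k
  rw [sub_smul, sub_smul, ← Submodule.map_sup, h k, Submodule.map_top, LinearEquiv.range]

lemma transverse_smul_iff {F G : CompleteFlag d} (g : GL (Fin d) ℝ) :
    (g • F).Transverse (g • G) ↔ F.Transverse G :=
  ⟨fun h => by simpa using h.smul g⁻¹, fun h => h.smul g⟩

end CompleteFlag

lemma standardFlag_transverse_oppositeFlag : (standardFlag d).Transverse (oppositeFlag d) := by
  intro k
  rw [eq_top_iff]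
  intro v _
  rw [Submodule.mem_sup]
  refine ⟨fun i => if (i : ℕ) < k then v i else 0, ?_, fun i => if (i : ℕ) < k then 0 else v i, ?_, ?_⟩
  · rw [mem_standardFlag]
    intro i hi
    rw [if_neg (by omega)]
  · rw [mem_oppositeFlag]
    intro i hi
    have := k.2
    rw [if_pos (by simp at hi; omega)]
  · funext i
    by_cases h : (i : ℕ) < k <;> simp [h]

lemma exists_glEquiv_eq_sum {v : Fin d → Fin d → ℝ} (hv : LinearIndependent ℝ v) :
    ∃ g : GL (Fin d) ℝ, ∀ w, glEquiv g w = ∑ j, w j • v j := by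
  refine ⟨Matrix.GeneralLinearGroup.mkOfDetNeZero (Matrix.of fun i j => v j i) ?_, fun w => ?_⟩
  · have h1 : LinearIndependent ℝ (Matrix.of fun i j => v i j).row := hv
    rw [Matrix.linearIndependent_rows_iff_isUnit, Matrix.isUnit_iff_isUnit_det] at h1
    have : (Matrix.of fun i j => v j i) = (Matrix.of fun i j => v i j).transpose := rfl
    rw [this, Matrix.det_transpose]
    exact h1.ne_zero
  · funext i
    rw [glEquiv_apply]
    change ∑ j, v j i * w j = _
    simp [mul_comm]

/-- Every complete flag is in the orbit of the standard one: choose `vᵢ ∈ Fⁱ⁺¹ \ Fⁱ`. -/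
lemma exists_smul_standardFlag (F : CompleteFlag d) :
    ∃ g : GL (Fin d) ℝ, g • standardFlag d = F := by
  have hex : ∀ i : Fin d, ∃ v ∈ F.sub i.succ, v ∉ F.sub i.castSucc := by
    intro i
    refine Set.not_subset.1 fun h => ?_
    have := Submodule.finrank_mono (R := ℝ) (s := F.sub i.succ) (t := F.sub i.castSucc) h
    rw [F.finrank_sub, F.finrank_sub] at this
    simp at this
  choose v hv hv' using hex
  have hli : LinearIndependent ℝ v := by
    rw [Fintype.linearIndependent_iff]
    intro c hc
    by_contra! hcon
    have hne : (Finset.univ.filter fun i => c i ≠ 0).Nonempty := by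
      obtain ⟨i, hi⟩ := hcon
      exact ⟨i, by simp [hi]⟩
    obtain ⟨i, hi, hmax⟩ := Finset.exists_max_image _ id hne
    simp only [Finset.mem_filter, Finset.mem_univ, true_and, id] at hi hmax
    have hrest : ∑ j ∈ Finset.univ.erase i, c j • v j ∈ F.sub i.castSucc := by
      refine Submodule.sum_mem _ fun j hj => ?_
      by_cases h0 : c j = 0
      · simp [h0]
      · refine Submodule.smul_mem _ _ (F.mono ?_ (hv j))
        have h1 := lt_of_le_of_ne (hmax j h0) (Finset.ne_of_mem_erase hj)
        rw [Fin.le_def]; simpa using h1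
    rw [← Finset.add_sum_erase _ _ (Finset.mem_univ i), add_eq_zero_iff_eq_neg] at hc
    have h2 : c i • v i ∈ F.sub i.castSucc := by rw [hc]; exact neg_mem hrest
    exact hv' i ((Submodule.smul_mem_iff _ hi).1 h2)
  obtain ⟨g, hg⟩ := exists_glEquiv_eq_sum hli
  refine ⟨g, CompleteFlag.eq_of_le fun k => ?_⟩
  rw [sub_smul, Submodule.map_le_iff_le_comap]
  intro w hw
  rw [mem_standardFlag] at hw
  rw [Submodule.mem_comap, LinearEquiv.coe_coe, hg]
  refine Submodule.sum_mem _ fun j _ => ?_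
  by_cases hj : (k : ℕ) ≤ j
  · simp [hw j hj]
  · exact Submodule.smul_mem _ _ (F.mono (by rw [Fin.le_def]; simp; omega) (hv j))

lemma isOpenQuotientMap_smul_standardFlag (d : ℕ) :
    IsOpenQuotientMap fun g : GL (Fin d) ℝ => g • standardFlag d where
  surjective := exists_smul_standardFlag
  continuous := continuous_coinduced_rng
  isOpenMap := by
    intro U hU
    rw [isOpen_coinduced]
    have : (fun g : GL (Fin d) ℝ => g • standardFlag d) ⁻¹'
        ((fun g : GL (Fin d) ℝ => g • standardFlag d) '' U) =
        ⋃ b ∈ MulAction.stabilizer (GL (Fin d) ℝ) (standardFlag d), (fun g => g * b) ⁻¹' U := by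
      ext g
      simp only [Set.mem_preimage, Set.mem_image, Set.mem_iUnion, MulAction.mem_stabilizer_iff]
      constructor
      · rintro ⟨h, hU, e⟩
        exact ⟨g⁻¹ * h, by rw [mul_smul, e, inv_smul_smul], by simpa using hU⟩
      · rintro ⟨b, hb, hg⟩
        exact ⟨g * b, hg, by rw [mul_smul, hb]⟩
    rw [this]
    exact isOpen_biUnion fun b _ => hU.preimage (continuous_mul_const b)

/-- Nonvanishing of the upper right corner minors expresses that the opposite flag is transverse to its
image. -/
lemma contiguousMinor_ne_zero_of_transverse {U : GL (Fin d) ℝ}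
    (h : (U • oppositeFlag d).Transverse (oppositeFlag d)) {k : ℕ} (hk : k ≤ d) :
    contiguousMinor (U : Matrix (Fin d) (Fin d) ℝ) 0 (d - k) k ≠ 0 := by
  rw [contiguousMinor_eq _ (by omega) (by omega)]
  intro h0
  obtain ⟨v, hv0, hv⟩ := Matrix.exists_mulVec_eq_zero_iff.2 h0
  let w : Fin d → ℝ := fun j => if hj : d - k ≤ j then v ⟨j - (d - k), by omega⟩ else 0
  have hwq : ∀ q : Fin k, w ⟨d - k + q, by omega⟩ = v q := by
    intro q
    simp only [w]
    rw [dif_pos (by omega)]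
    congr 1; ext; simp
  have hsum : ∀ f : Fin d → ℝ, ∑ j, f j * w j =
      ∑ q : Fin k, f ⟨d - k + q, by omega⟩ * v q := by
    intro f
    symm
    refine Finset.sum_of_injOn (fun q : Fin k => (⟨d - k + q, by omega⟩ : Fin d)) ?_ ?_ ?_ ?_
    · intro a _ b _ hab
      simp only [Fin.mk.injEq] at hab
      ext; omega
    · intro q _; simp
    · intro j _ hj
      have : ¬ d - k ≤ j := fun hle => hj ⟨⟨j - (d - k), by omega⟩, by simp, by
        ext; simp; omega⟩
      simp only [w, dif_neg this, mul_zero]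
    · intro q _
      rw [hwq]
  have hw : w ∈ (oppositeFlag d).sub ⟨k, by omega⟩ := by
    rw [mem_oppositeFlag]
    intro i hi
    simp only at hi
    simp only [w]
    rw [dif_neg (by omega)]
  have hUw : glEquiv U w ∈ (oppositeFlag d).sub (Fin.rev ⟨k, by omega⟩) := by
    rw [mem_oppositeFlag]
    intro i hi
    simp only [Fin.val_rev] at hi
    have h1 := congrFun hv ⟨i, by omega⟩
    simp only [Matrix.mulVec, dotProduct, Matrix.submatrix_apply, Pi.zero_apply, zero_add] at h1
    rw [glEquiv_apply]
    simp only [Matrix.mulVec, dotProduct]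
    rw [hsum]
    exact h1
  have h2 := h.eq_zero ⟨k, by omega⟩ (v := glEquiv U w)
    (by rw [mem_sub_smul, glEquiv_inv_apply]; exact hw) hUw
  rw [map_eq_zero_iff _ (LinearEquiv.injective _)] at h2
  refine hv0 (funext fun q => ?_)
  rw [← hwq, h2]
  rfl

/-! ### Unipotent coordinates of flags transverse to a given one -/

/-- The linear system whose solution is the `k`-th column of `unipotentFactor A`: the first `k`
rows are those of `A`, the others those of the identity matrix. -/
def eliminationMatrix (A : Matrix (Fin d) (Fin d) ℝ) (k : Fin d) : Matrix (Fin d) (Fin d) ℝ :=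
  Matrix.of fun i j => if i < k then A i j else if i = j then 1 else 0

/-- Gaussian elimination: if the systems above are regular, this is the upper triangular unipotent
matrix `X` for which `A * X` is lower triangular. -/
noncomputable def unipotentFactor (A : Matrix (Fin d) (Fin d) ℝ) : Matrix (Fin d) (Fin d) ℝ :=
  Matrix.of fun i k => (eliminationMatrix A k)⁻¹ i k

section unipotentFactor

variable {A : Matrix (Fin d) (Fin d) ℝ}

lemma eliminationMatrix_mul_inv (hA : ∀ k, (eliminationMatrix A k).det ≠ 0) (i k : Fin d) :
    ∑ j, eliminationMatrix A k i j * unipotentFactor A j k = if i = k then 1 else 0 := by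
  have := Matrix.mul_nonsing_inv (eliminationMatrix A k) (isUnit_iff_ne_zero.2 (hA k))
  have h2 := congrFun (congrFun this i) k
  rw [Matrix.mul_apply, Matrix.one_apply] at h2
  exact h2

lemma unipotentFactor_of_le (hA : ∀ k, (eliminationMatrix A k).det ≠ 0) {i k : Fin d}
    (h : k ≤ i) : unipotentFactor A i k = if i = k then 1 else 0 := by
  rw [← eliminationMatrix_mul_inv hA i k]
  simp [eliminationMatrix, not_lt.2 h]

lemma unipotentFactor_upper (hA : ∀ k, (eliminationMatrix A k).det ≠ 0) (i j : Fin d)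
    (h : j < i) : unipotentFactor A i j = 0 := by
  rw [unipotentFactor_of_le hA h.le, if_neg h.ne']

lemma unipotentFactor_diag (hA : ∀ k, (eliminationMatrix A k).det ≠ 0) (i : Fin d) :
    unipotentFactor A i i = 1 := by
  rw [unipotentFactor_of_le hA le_rfl, if_pos rfl]

lemma mul_unipotentFactor_lower (hA : ∀ k, (eliminationMatrix A k).det ≠ 0) (i k : Fin d)
    (h : i < k) : (A * unipotentFactor A) i k = 0 := by
  have := eliminationMatrix_mul_inv hA i k
  rw [if_neg h.ne] at this
  rw [Matrix.mul_apply, ← this]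
  simp [eliminationMatrix, h]

lemma continuousAt_unipotentFactor (hA : ∀ k, (eliminationMatrix A k).det ≠ 0) :
    ContinuousAt (unipotentFactor (d := d)) A := by
  refine tendsto_pi_nhds.2 fun i => tendsto_pi_nhds.2 fun k => ?_
  have hc : Continuous fun A : Matrix (Fin d) (Fin d) ℝ => eliminationMatrix A k := by
    refine continuous_matrix fun i j => ?_
    simp only [eliminationMatrix, Matrix.of_apply]
    split_ifs <;> fun_prop
  have h1 : ContinuousAt (fun A : Matrix (Fin d) (Fin d) ℝ =>
      (eliminationMatrix A k).det⁻¹ * (eliminationMatrix A k).adjugate i k) A :=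
    (hc.matrix_det.continuousAt.inv₀ (hA k)).mul
      (hc.matrix_adjugate.matrix_elem i k).continuousAt
  refine h1.tendsto.congr' ?_ |>.trans (le_of_eq ?_)
  · filter_upwards with A
    simp [unipotentFactor, Matrix.inv_def, Ring.inverse_eq_inv']
  · simp [unipotentFactor, Matrix.inv_def, Ring.inverse_eq_inv']

end unipotentFactor

lemma det_ne_zero_of_upper_unipotent {M : Matrix (Fin d) (Fin d) ℝ} (hu : ∀ i j, j < i → M i j = 0)
    (hd : ∀ i, M i i = 1) : M.det ≠ 0 := by
  rw [Matrix.det_of_isUpperTriangular (fun i j h => hu i j h)]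
  simp [hd]

/-- The elimination systems of `h⁻¹ g` are regular when `g` and `h` carry the standard and the
opposite flag to transverse flags: a kernel vector would give a common vector of complementary
subspaces of these flags. -/
lemma det_eliminationMatrix_ne_zero {g h : GL (Fin d) ℝ}
    (hgh : (g • standardFlag d).Transverse (h • oppositeFlag d)) (k : Fin d) :
    (eliminationMatrix (h⁻¹ * g : GL (Fin d) ℝ) k).det ≠ 0 := by
  intro h0
  obtain ⟨v, hv0, hv⟩ := Matrix.exists_mulVec_eq_zero_iff.2 h0
  have h1 : ∀ i, k ≤ i → v i = 0 := by
    intro i hi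
    have := congrFun hv i
    simpa [Matrix.mulVec, dotProduct, eliminationMatrix, not_lt.2 hi] using this
  have h2 : ∀ i, i < k → glEquiv (h⁻¹ * g) v i = 0 := by
    intro i hi
    have := congrFun hv i
    simp only [Matrix.mulVec, dotProduct, eliminationMatrix, Matrix.of_apply, if_pos hi,
      Pi.zero_apply] at this
    rw [glEquiv_apply]
    exact this
  have h3 := hgh.eq_zero k.castSucc (v := glEquiv g v)
    (by
      rw [mem_sub_smul, glEquiv_inv_apply, mem_standardFlag]
      exact fun i hi => h1 i (by rw [Fin.le_def]; simpa using hi))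
    (by
      rw [mem_sub_smul, ← glEquiv_mul, mem_oppositeFlag]
      intro i hi
      refine h2 i ?_
      rw [Fin.lt_def]
      simp at hi; omega)
  exact hv0 ((map_eq_zero_iff _ (LinearEquiv.injective _)).1 h3)

/-- A flag transverse to `g • std` is of the form `(g X) • opp` with `X` upper unipotent, and `X`
is given by Gaussian elimination. -/
lemma exists_unipotent_coordinate {g h : GL (Fin d) ℝ}
    (hgh : (g • standardFlag d).Transverse (h • oppositeFlag d)) :
    ∃ X ∈ upperUnipotent d, (X : Matrix (Fin d) (Fin d) ℝ) =
      unipotentFactor (h⁻¹ * g : GL (Fin d) ℝ) ∧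
      h • oppositeFlag d = (g * X) • oppositeFlag d := by
  have hA := det_eliminationMatrix_ne_zero hgh
  have hu := unipotentFactor_upper hA
  have hd := unipotentFactor_diag hA
  let X : GL (Fin d) ℝ :=
    Matrix.GeneralLinearGroup.mkOfDetNeZero _ (det_ne_zero_of_upper_unipotent hu hd)
  refine ⟨X, ⟨hu, hd⟩, rfl, ?_⟩
  have : (h⁻¹ * g * X) • oppositeFlag d = oppositeFlag d := by
    refine smul_oppositeFlag_of_lower fun i j hij => ?_
    exact mul_unipotentFactor_lower hA i j hij
  conv_lhs => rw [← this]
  rw [← mul_smul]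
  congr 1
  group

/-! ### Positivity in unipotent coordinates -/

/-- The invertible diagonal matrix with the given entries. -/
noncomputable def diagonalGL (l : Fin d → ℝ) (hl : ∀ i, l i ≠ 0) : GL (Fin d) ℝ :=
  Matrix.GeneralLinearGroup.mkOfDetNeZero (Matrix.diagonal l)
    (by rw [Matrix.det_diagonal]; exact Finset.prod_ne_zero_iff.2 fun i _ => hl i)

lemma coe_diagonalGL (l : Fin d → ℝ) (hl : ∀ i, l i ≠ 0) :
    (diagonalGL l hl : Matrix (Fin d) (Fin d) ℝ) = Matrix.diagonal l := rfl

lemma coe_diagonalGL_inv (l : Fin d → ℝ) (hl : ∀ i, l i ≠ 0) :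
    ((diagonalGL l hl)⁻¹ : GL (Fin d) ℝ) = diagonalGL (fun i => (l i)⁻¹)
      (fun i => inv_ne_zero (hl i)) := by
  rw [inv_eq_iff_mul_eq_one]
  refine Units.ext ?_
  rw [Units.val_mul, coe_diagonalGL, coe_diagonalGL, Matrix.diagonal_mul_diagonal]
  simp [hl]

lemma diagonalGL_smul_oppositeFlag (l : Fin d → ℝ) (hl : ∀ i, l i ≠ 0) :
    diagonalGL l hl • oppositeFlag d = oppositeFlag d :=
  smul_oppositeFlag_of_lower fun i j h => by rw [coe_diagonalGL]; simp [h.ne]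

lemma diagonalGL_smul_standardFlag (l : Fin d → ℝ) (hl : ∀ i, l i ≠ 0) :
    diagonalGL l hl • standardFlag d = standardFlag d :=
  smul_standardFlag_of_upper fun i j h => by rw [coe_diagonalGL]; simp [h.ne']

/-- The basis of the columns of an invertible matrix. -/
noncomputable def columnBasis (P : GL (Fin d) ℝ) : Module.Basis (Fin d) ℝ (Fin d → ℝ) :=
  (Pi.basisFun ℝ (Fin d)).map (glEquiv P)

lemma columnBasis_apply (P : GL (Fin d) ℝ) (i : Fin d) :
    columnBasis P i = glEquiv P (Pi.single i 1) := by
  simp [columnBasis]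

lemma toMatrix_columnBasis (P g : GL (Fin d) ℝ) :
    LinearMap.toMatrix (columnBasis P) (columnBasis P)
      (Matrix.toLin' (g : Matrix (Fin d) (Fin d) ℝ)) = (P⁻¹ * g * P : GL (Fin d) ℝ) := by
  ext i j
  rw [LinearMap.toMatrix_apply, columnBasis_apply, columnBasis, Module.Basis.map_repr]
  simp only [LinearEquiv.trans_apply, Pi.basisFun_repr]
  have h1 : (glEquiv P).symm = glEquiv P⁻¹ := by
    ext1 v
    rw [LinearEquiv.symm_apply_eq, glEquiv_apply_inv]
  have h2 : Matrix.toLin' (g : Matrix (Fin d) (Fin d) ℝ) (glEquiv P (Pi.single j 1)) =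
      glEquiv g (glEquiv P (Pi.single j 1)) := rfl
  rw [h1, h2, ← glEquiv_mul, ← glEquiv_mul, glEquiv_apply, Matrix.mulVec_single_one]
  rfl

lemma exists_eq_columnBasis (b : Module.Basis (Fin d) ℝ (Fin d → ℝ)) :
    ∃ P : GL (Fin d) ℝ, b = columnBasis P := by
  obtain ⟨P, hP⟩ := exists_glEquiv_eq_sum b.linearIndependent
  refine ⟨P, Module.Basis.eq_of_apply_eq fun i => ?_⟩
  rw [columnBasis_apply, hP, Finset.sum_eq_single i] <;> simp +contextual

/-- The homomorphism sending a matrix `V` to the projective transformation that it represents in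
the basis of the columns of `B`. -/
noncomputable def representedBy (B : GL (Fin d) ℝ) : GL (Fin d) ℝ →* PGL(Fin d, ℝ) :=
  (Matrix.ProjGenLinGroup.mk).comp (MulAut.conj B).toMonoidHom

lemma representedBy_smul (B V : GL (Fin d) ℝ) (F : CompleteFlag d) :
    representedBy B V • F = (B * V * B⁻¹) • F := rfl

lemma mem_positiveUnipotents_columnBasis {P : GL (Fin d) ℝ} {u : PGL(Fin d, ℝ)} :
    u ∈ positiveUnipotents (columnBasis P) ↔ ∃ V : GL (Fin d) ℝ, representedBy P V = u ∧
      IsTotallyPositiveUnipotent (V : Matrix (Fin d) (Fin d) ℝ) := by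
  constructor
  · rintro ⟨g, hg, hV⟩
    refine ⟨P⁻¹ * g * P, ?_, by rwa [toMatrix_columnBasis] at hV⟩
    rw [← hg]
    change Matrix.ProjGenLinGroup.mk (P * (P⁻¹ * g * P) * P⁻¹) = _
    congr 1; group
  · rintro ⟨V, hV, h⟩
    refine ⟨P * V * P⁻¹, hV, ?_⟩
    rw [toMatrix_columnBasis]
    convert h using 2
    group

lemma IsTotallyPositiveUnipotent.mem_upperUnipotent {V : GL (Fin d) ℝ}
    (h : IsTotallyPositiveUnipotent (V : Matrix (Fin d) (Fin d) ℝ)) : V ∈ upperUnipotent d :=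
  ⟨h.upper, h.diag⟩

/-- Conjugation of a matrix by a diagonal matrix of signs. -/
def signConj (ε : Fin d → ℤˣ) (M : Matrix (Fin d) (Fin d) ℝ) : Matrix (Fin d) (Fin d) ℝ :=
  Matrix.of fun i j => ((ε i : ℤ) : ℝ) * M i j * ((ε j : ℤ) : ℝ)

lemma unit_cast_mul_self (e : ℤˣ) : ((e : ℤ) : ℝ) * ((e : ℤ) : ℝ) = 1 := by
  rcases Int.units_eq_one_or e with rfl | rfl <;> simp

lemma unit_cast_ne_zero (e : ℤˣ) : ((e : ℤ) : ℝ) ≠ 0 :=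
  left_ne_zero_of_mul_eq_one (unit_cast_mul_self e)

lemma signConj_eq (ε : Fin d → ℤˣ) (V : GL (Fin d) ℝ) :
    signConj ε (V : Matrix (Fin d) (Fin d) ℝ) =
      ((diagonalGL (fun i => ((ε i : ℤ) : ℝ)) fun _ => unit_cast_ne_zero _)⁻¹ * V *
        diagonalGL (fun i => ((ε i : ℤ) : ℝ)) fun _ => unit_cast_ne_zero _ : GL (Fin d) ℝ) := by
  rw [coe_diagonalGL_inv, Units.val_mul, Units.val_mul, coe_diagonalGL, coe_diagonalGL]
  ext i j
  rw [Matrix.mul_diagonal, Matrix.diagonal_mul]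
  have : (((ε i : ℤ) : ℝ))⁻¹ = ((ε i : ℤ) : ℝ) := inv_eq_of_mul_eq_one_left (unit_cast_mul_self _)
  simp [signConj, this]

lemma prod_Ico_telescope {G : Type*} [Group G] (X : ℕ → G) {j m : ℕ} (hj : j ≤ m) :
    ((List.Ico j m).reverse.map fun l => (X (l + 1))⁻¹ * X l).prod = (X m)⁻¹ * X j := by
  induction hn : m - j generalizing j with
  | zero =>
    obtain rfl : j = m := by omega
    simp
  | succ n ih =>
    rw [List.Ico.eq_cons (by omega), List.reverse_cons, List.map_append, List.prod_append,
      ih (by omega) (by omega)]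
    simp

/-- Suppose the flags are written as `F₀ = g • std` and `Fⱼ = (g Xⱼ) • opp` with `Xⱼ` upper unipotent.
Then the tuple is positive if and only if all the matrices `Xⱼ₊₁⁻¹ Xⱼ` become totally positive after
a common conjugation by a diagonal matrix of signs: the basis adapted to the first and the last
flag is unique up to rescaling its vectors. -/
theorem isPositiveTuple_iff {m : ℕ} {F : Fin (m + 1) → CompleteFlag d} {g : GL (Fin d) ℝ}
    {X : ℕ → GL (Fin d) ℝ} (hm : 1 ≤ m) (hX : ∀ j, X j ∈ upperUnipotent d)
    (h0 : F 0 = g • standardFlag d)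
    (hF : ∀ j : Fin (m + 1), 0 < (j : ℕ) → F j = (g * X j) • oppositeFlag d) :
    IsPositiveTuple F ↔ ∃ ε : Fin d → ℤˣ, ∀ j, 0 < j → j < m →
      IsTotallyPositiveUnipotent (signConj ε ((X (j + 1))⁻¹ * X j : GL (Fin d) ℝ)) := by
  set B := g * X m with hB
  have hX0 : ∀ j, X j • standardFlag d = standardFlag d := fun j =>
    smul_standardFlag_of_upper (hX j).1
  have hFm : F (Fin.last m) = B • oppositeFlag d := by
    rw [hF _ (by simp; omega)]; simp [hB]
  have hF0 : F 0 = B • standardFlag d := by rw [h0, hB, mul_smul, hX0]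
  have hFj : ∀ j : Fin (m + 1), 0 < (j : ℕ) →
      F j = (B * ((X m)⁻¹ * X j)) • oppositeFlag d := by
    intro j hj
    rw [hF j hj, hB]; congr 1; group
  constructor
  · rintro ⟨-, b, u, hu, hb, hFu⟩
    obtain ⟨P, rfl⟩ := exists_eq_columnBasis b
    -- the adapted basis consists of multiples of the columns of `B`
    have hD : ∀ i j, i ≠ j → (B⁻¹ * P : GL (Fin d) ℝ) i j = 0 := by
      intro i j hij
      have h1 := hb j
      rw [hF0, hFm, Submodule.mem_inf, mem_sub_smul, mem_sub_smul, mem_standardFlag,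
        mem_oppositeFlag, columnBasis_apply, ← glEquiv_mul, glEquiv_apply,
        Matrix.mulVec_single_one] at h1
      rcases lt_or_gt_of_ne hij with h | h
      · exact h1.2 i (by have : (i : ℕ) < j := h; simp; omega)
      · exact h1.1 i (by have : (j : ℕ) < i := h; simp; omega)
    have hl : ∀ i, (B⁻¹ * P : GL (Fin d) ℝ) i i ≠ 0 := by
      intro i hi
      refine (B⁻¹ * P : GL (Fin d) ℝ).det_ne_zero (Matrix.det_eq_zero_of_row_eq_zero i fun j => ?_)
      by_cases hij : i = j
      · rw [← hij, hi]
      · exact hD i j hij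
    set l : Fin d → ℝ := fun i => (B⁻¹ * P : GL (Fin d) ℝ) i i with hld
    have hPD : P = B * diagonalGL l hl := by
      rw [← inv_mul_eq_iff_eq_mul]
      rw [Matrix.GeneralLinearGroup.ext_iff]
      intro i j
      rw [coe_diagonalGL]
      by_cases hij : i = j
      · subst hij; simp [hld]
      · rw [Matrix.diagonal_apply_ne _ hij, hD i j hij]
    set D := diagonalGL l hl with hDd
    have hV : ∀ j, ∃ V : GL (Fin d) ℝ, V ∈ upperUnipotent d ∧ (0 < j → j < m →
        representedBy B V = u j ∧
        IsTotallyPositiveUnipotent (D⁻¹ * V * D : GL (Fin d) ℝ).val) := by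
      intro j
      by_cases hj : 0 < j ∧ j < m
      · obtain ⟨V, hV, hpos⟩ := mem_positiveUnipotents_columnBasis.1 (hu j hj.1 hj.2)
        have hup := hpos.mem_upperUnipotent
        refine ⟨D * V * D⁻¹, ⟨fun a c hac => ?_, fun a => ?_⟩, fun _ _ => ⟨?_, ?_⟩⟩
        · rw [hDd, coe_diagonalGL_inv, Units.val_mul, Units.val_mul, coe_diagonalGL, coe_diagonalGL,
            Matrix.mul_diagonal, Matrix.diagonal_mul, hup.1 a c hac]
          simp
        · rw [hDd, coe_diagonalGL_inv, Units.val_mul, Units.val_mul, coe_diagonalGL, coe_diagonalGL,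
            Matrix.mul_diagonal, Matrix.diagonal_mul, hup.2 a]
          have : l a ≠ 0 := hl a
          field_simp
        · rw [← hV, hPD]
          change Matrix.ProjGenLinGroup.mk (B * (D * V * D⁻¹) * B⁻¹) =
            Matrix.ProjGenLinGroup.mk (B * D * V * (B * D)⁻¹)
          congr 1; group
        · convert hpos using 2; group
      · exact ⟨1, one_mem _, fun h1 h2 => absurd ⟨h1, h2⟩ hj⟩
    choose V hVu hV using hV
    have hY : ∀ j, 0 < j → j ≤ m → (X m)⁻¹ * X j = ((List.Ico j m).reverse.map V).prod := by
      intro j hj hjm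
      rcases hjm.eq_or_lt with rfl | hlt
      · simp
      have hYu : ((List.Ico j m).reverse.map V).prod ∈ upperUnipotent d := by
        refine Subgroup.list_prod_mem _ fun x hx => ?_
        obtain ⟨i, -, rfl⟩ := List.mem_map.1 hx
        exact hVu i
      refine eq_of_smul_oppositeFlag_eq (mul_mem (inv_mem (hX m)) (hX j)) hYu ?_
      have h1 := hFu ⟨j, by omega⟩ hj hlt
      rw [hFj _ hj, hFm] at h1
      have h2 : ((List.Ico j m).reverse.map u).prod =
          representedBy B ((List.Ico j m).reverse.map V).prod := by
        rw [map_list_prod, List.map_map]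
        congr 1
        refine List.map_congr_left fun i hi => ?_
        rw [List.mem_reverse, List.Ico.mem] at hi
        exact (hV i (by omega) hi.2).1.symm
      rw [h2, representedBy_smul, ← mul_smul, inv_mul_cancel_right, mul_smul B, mul_smul B] at h1
      exact MulAction.injective B h1
    have hsucc : ∀ j, 0 < j → j < m → (X (j + 1))⁻¹ * X j = V j := by
      intro j hj hjm
      have h1 := hY j hj hjm.le
      rw [List.Ico.eq_cons hjm, List.reverse_cons, List.map_append, List.prod_append,
        ← hY (j + 1) (by omega) hjm] at h1
      simp only [List.map_cons, List.map_nil, List.prod_cons, List.prod_nil, mul_one] at h1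
      rw [mul_assoc, mul_right_inj] at h1
      rw [h1]; group
    refine ⟨fun i => if 0 < l i then 1 else -1, fun j hj hjm => ?_⟩
    rw [hsucc j hj hjm]
    have h1 := (hV j hj hjm).2.conj_diagonal (l := fun i => |l i|) fun i => abs_pos.2 (hl i)
    convert h1 using 1
    ext a c
    rw [hDd, coe_diagonalGL_inv, Units.val_mul, Units.val_mul, coe_diagonalGL, coe_diagonalGL]
    simp only [signConj, Matrix.of_apply, Matrix.mul_diagonal, Matrix.diagonal_mul]
    have hsgn : ∀ i, |l i| = (((if 0 < l i then 1 else -1 : ℤˣ) : ℤ) : ℝ) * l i := by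
      intro i
      split_ifs with h
      · rw [abs_of_pos h]; simp
      · rw [abs_of_nonpos (not_lt.1 h)]; simp
    rw [hsgn a, hsgn c]
    have ha : l a ≠ 0 := hl a
    have hc : l c ≠ 0 := hl c
    have hinv : ((((if 0 < l c then 1 else -1 : ℤˣ) : ℤ) : ℝ))⁻¹ =
      (((if 0 < l c then 1 else -1 : ℤˣ) : ℤ) : ℝ) :=
        inv_eq_of_mul_eq_one_left (unit_cast_mul_self _)
    rw [mul_inv, hinv]
    field_simp
  · rintro ⟨ε, hε⟩
    set D := diagonalGL (fun i => ((ε i : ℤ) : ℝ)) (fun i => unit_cast_ne_zero _) with hDd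
    refine ⟨?_, columnBasis (B * D), fun j => representedBy B ((X (j + 1))⁻¹ * X j), ?_, ?_, ?_⟩
    · rw [hF0, hFm]
      exact standardFlag_transverse_oppositeFlag.smul B
    · intro j hj hjm
      rw [mem_positiveUnipotents_columnBasis]
      refine ⟨D⁻¹ * ((X (j + 1))⁻¹ * X j) * D, ?_, ?_⟩
      · change Matrix.ProjGenLinGroup.mk (B * D * (D⁻¹ * ((X (j + 1))⁻¹ * X j) * D) * (B * D)⁻¹) =
          Matrix.ProjGenLinGroup.mk (B * ((X (j + 1))⁻¹ * X j) * B⁻¹)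
        congr 1; group
      · have := hε j hj hjm
        rwa [signConj_eq] at this
    · intro i
      have e0 : F 0 = (B * D) • standardFlag d := by
        rw [mul_smul, hDd, diagonalGL_smul_standardFlag, hF0]
      have em : F (Fin.last m) = (B * D) • oppositeFlag d := by
        rw [mul_smul, hDd, diagonalGL_smul_oppositeFlag, hFm]
      rw [e0, em, columnBasis_apply, Submodule.mem_inf, mem_sub_smul, mem_sub_smul,
        glEquiv_inv_apply, mem_standardFlag, mem_oppositeFlag]
      constructor
      · intro a ha
        have : a ≠ i := by rintro rfl; simp at ha
        simp [this]
      · intro a ha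
        have : a ≠ i := by rintro rfl; simp at ha
        simp [this]
    · intro j hj hjm
      have h2 : ((List.Ico j m).reverse.map fun j => representedBy B ((X (j + 1))⁻¹ * X j)).prod =
          representedBy B ((X m)⁻¹ * X j) := by
        rw [← prod_Ico_telescope X hjm.le, map_list_prod, List.map_map]
        rfl
      rw [h2, hFj j hj, representedBy_smul, hFm, ← mul_smul, inv_mul_cancel_right]

/-! ### Positivity along connected families of transverse tuples -/

lemma smul_standardFlag_eq (g : GL (Fin d) ℝ) :
    g • standardFlag d = (g * reversal d) • oppositeFlag d := by
  rw [oppositeFlag, ← mul_smul, mul_assoc]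
  nth_rewrite 2 [← reversal_inv]
  rw [mul_inv_cancel, mul_one]

section Lift

variable {m : ℕ}

/-- For a tuple `g` of frames, the unipotent coordinate of the `j`-th flag `gⱼ • std` with respect to
`g₀`. -/
noncomputable def coordinate (g : Fin (m + 1) → GL (Fin d) ℝ) (j : ℕ) : Matrix (Fin d) (Fin d) ℝ :=
  unipotentFactor (((g (Fin.ofNat (m + 1) j) * reversal d)⁻¹ * g 0 : GL (Fin d) ℝ))

/-- The unipotent matrix relating the `j`-th and the `(j + 1)`-st flag of a tuple. -/
noncomputable def transition (g : Fin (m + 1) → GL (Fin d) ℝ) (j : ℕ) :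
    Matrix (Fin d) (Fin d) ℝ :=
  (coordinate g (j + 1))⁻¹ * coordinate g j

/-- The flags of the tuple of frames `g` are pairwise transverse. -/
def IsTransverseFrameTuple (g : Fin (m + 1) → GL (Fin d) ℝ) : Prop :=
  ∀ i j, i ≠ j → (g i • standardFlag d).Transverse (g j • standardFlag d)

variable {g : Fin (m + 1) → GL (Fin d) ℝ}

lemma ofNat_ne_zero {j : ℕ} (hj : 0 < j) (hjm : j ≤ m) : (0 : Fin (m + 1)) ≠ Fin.ofNat (m + 1) j := by
  intro h
  have := congrArg Fin.val h
  simp only [Fin.val_zero, Fin.val_ofNat] at this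
  rw [Nat.mod_eq_of_lt (by omega)] at this
  omega

lemma IsTransverseFrameTuple.transverse_zero (hg : IsTransverseFrameTuple g) {j : ℕ} (hj : 0 < j)
    (hjm : j ≤ m) : (g 0 • standardFlag d).Transverse
      ((g (Fin.ofNat (m + 1) j) * reversal d) • oppositeFlag d) := by
  rw [← smul_standardFlag_eq]
  exact hg _ _ (ofNat_ne_zero hj hjm)

lemma IsTransverseFrameTuple.exists_coordinate (hg : IsTransverseFrameTuple g) :
    ∃ X : ℕ → GL (Fin d) ℝ, (∀ j, X j ∈ upperUnipotent d) ∧ ∀ j, 0 < j → j ≤ m →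
      (X j : Matrix (Fin d) (Fin d) ℝ) = coordinate g j ∧
      g (Fin.ofNat (m + 1) j) • standardFlag d = (g 0 * X j) • oppositeFlag d := by
  have : ∀ j, ∃ X ∈ upperUnipotent d, 0 < j → j ≤ m →
      (X : Matrix (Fin d) (Fin d) ℝ) = coordinate g j ∧
      g (Fin.ofNat (m + 1) j) • standardFlag d = (g 0 * X) • oppositeFlag d := by
    intro j
    by_cases h : 0 < j ∧ j ≤ m
    · obtain ⟨X, hX, h1, h2⟩ := exists_unipotent_coordinate (hg.transverse_zero h.1 h.2)
      exact ⟨X, hX, fun _ _ => ⟨h1, by rw [smul_standardFlag_eq, h2]⟩⟩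
    · exact ⟨1, one_mem _, fun h1 h2 => absurd ⟨h1, h2⟩ h⟩
  choose X hX h using this
  exact ⟨X, hX, h⟩

lemma IsTransverseFrameTuple.exists_transition (hg : IsTransverseFrameTuple g) {j : ℕ} (hj : 0 < j)
    (hjm : j < m) : ∃ V ∈ upperUnipotent d, (V : Matrix (Fin d) (Fin d) ℝ) = transition g j ∧
      (V • oppositeFlag d).Transverse (oppositeFlag d) := by
  obtain ⟨X, hX, h⟩ := hg.exists_coordinate
  refine ⟨(X (j + 1))⁻¹ * X j, mul_mem (inv_mem (hX _)) (hX _), ?_, ?_⟩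
  · rw [transition, ← (h j hj hjm.le).1, ← (h (j + 1) (by omega) hjm).1, Units.val_mul,
      Matrix.coe_units_inv]
  · rw [← CompleteFlag.transverse_smul_iff (g 0 * X (j + 1)), ← (h (j + 1) (by omega) hjm).2,
      ← mul_smul]
    have : g 0 * X (j + 1) * ((X (j + 1))⁻¹ * X j) = g 0 * X j := by group
    rw [this, ← (h j hj hjm.le).2]
    refine hg _ _ fun h => ?_
    have := congrArg Fin.val h
    simp only [Fin.val_ofNat] at this
    rw [Nat.mod_eq_of_lt (by omega), Nat.mod_eq_of_lt (by omega)] at this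
    omega

lemma IsTransverseFrameTuple.isPositiveTuple_iff (hg : IsTransverseFrameTuple g) (hm : 1 ≤ m) :
    IsPositiveTuple (fun i => g i • standardFlag d) ↔ ∃ ε : Fin d → ℤˣ, ∀ j, 0 < j → j < m →
      IsTotallyPositiveUnipotent (signConj ε (transition g j)) := by
  obtain ⟨X, hX, h⟩ := hg.exists_coordinate
  rw [HitchinRigidity.isPositiveTuple_iff (g := g 0) hm hX rfl fun j hj => ?_]
  · refine exists_congr fun ε => forall_congr' fun j => forall_congr' fun hj =>
      forall_congr' fun hjm => ?_
    rw [transition, ← (h j hj hjm.le).1, ← (h (j + 1) (by omega) hjm).1, Units.val_mul,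
      Matrix.coe_units_inv]
  · have := (h j hj (by omega)).2
    simpa using this

lemma IsTransverseFrameTuple.continuousAt_coordinate (hg : IsTransverseFrameTuple g) {j : ℕ}
    (hj : 0 < j) (hjm : j ≤ m) : ContinuousAt (fun g => coordinate (m := m) (d := d) g j) g := by
  have h1 : ContinuousAt (fun g : Fin (m + 1) → GL (Fin d) ℝ =>
      (((g (Fin.ofNat (m + 1) j) * reversal d)⁻¹ * g 0 : GL (Fin d) ℝ) :
        Matrix (Fin d) (Fin d) ℝ)) g := by
    have : Continuous fun g : Fin (m + 1) → GL (Fin d) ℝ =>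
        (g (Fin.ofNat (m + 1) j) * reversal d)⁻¹ * g 0 := by fun_prop
    exact (Units.continuous_val.comp this).continuousAt
  exact ContinuousAt.comp (g := unipotentFactor) (x := g)
    (continuousAt_unipotentFactor (det_eliminationMatrix_ne_zero (hg.transverse_zero hj hjm))) h1

lemma IsTransverseFrameTuple.continuousAt_transition (hg : IsTransverseFrameTuple g) {j : ℕ}
    (hj : 0 < j) (hjm : j < m) : ContinuousAt (fun g => transition (m := m) (d := d) g j) g := by
  have hdet : (coordinate g (j + 1)).det ≠ 0 :=
    have hA := det_eliminationMatrix_ne_zero (hg.transverse_zero (by omega : 0 < j + 1) hjm)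
    det_ne_zero_of_upper_unipotent (unipotentFactor_upper hA) (unipotentFactor_diag hA)
  have h1 := hg.continuousAt_coordinate (by omega : 0 < j + 1) hjm
  have hinv : ContinuousAt (fun g => (coordinate (m := m) (d := d) g (j + 1))⁻¹) g := by
    simp only [Matrix.inv_def, Ring.inverse_eq_inv']
    have hd : ContinuousAt (fun g => (coordinate (m := m) (d := d) g (j + 1)).det) g :=
      (continuous_id.matrix_det.continuousAt).comp h1
    have ha : ContinuousAt (fun g => (coordinate (m := m) (d := d) g (j + 1)).adjugate) g :=
      (continuous_id.matrix_adjugate.continuousAt).comp h1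
    exact (hd.inv₀ hdet).smul ha
  exact hinv.mul (hg.continuousAt_coordinate hj hjm.le)

lemma continuous_signConj (ε : Fin d → ℤˣ) : Continuous (signConj (d := d) ε) := by
  refine continuous_matrix fun i j => ?_
  simp only [signConj, Matrix.of_apply]
  fun_prop

/-- Positivity is locally constant on pairwise transverse tuples: it is open because total
positivity is, and closed because the transition matrices of transverse tuples have nonvanishing
corner minors. -/
theorem IsTransverseFrameTuple.eventually_isPositiveTuple_iff (hg : IsTransverseFrameTuple g)
    (hm : 1 ≤ m) : ∀ᶠ g' in 𝓝 g, IsTransverseFrameTuple g' →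
      (IsPositiveTuple (fun i => g' i • standardFlag d) ↔
        IsPositiveTuple (fun i => g i • standardFlag d)) := by
  have key : ∀ ε : Fin d → ℤˣ, ∀ j ∈ Finset.Ioo 0 m, ∀ᶠ g' in 𝓝 g, IsTransverseFrameTuple g' →
      (IsTotallyPositiveUnipotent (signConj ε (transition g' j)) ↔
        IsTotallyPositiveUnipotent (signConj ε (transition g j))) := by
    intro ε j hj
    rw [Finset.mem_Ioo] at hj
    have hc : Tendsto (fun g' => signConj ε (transition g' j)) (𝓝 g)
        (𝓝 (signConj ε (transition g j))) :=
      ((continuous_signConj ε).tendsto _).comp (hg.continuousAt_transition hj.1 hj.2)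
    by_cases h : IsTotallyPositiveUnipotent (signConj ε (transition g j))
    · filter_upwards [hc.eventually h.eventually] with g' hg' ht
      refine iff_of_true (hg' ?_ ?_) h
      · obtain ⟨V, hV, e, -⟩ := ht.exists_transition hj.1 hj.2
        intro a b hab
        simp [signConj, ← e, hV.1 a b hab]
      · obtain ⟨V, hV, e, -⟩ := ht.exists_transition hj.1 hj.2
        intro a
        simp [signConj, ← e, hV.2 a, unit_cast_mul_self]
    · have hcl : signConj ε (transition g j) ∉ closure {M | IsTotallyPositiveUnipotent M} := by
        refine fun hcl => h (isTotallyPositiveUnipotent_of_mem_closure hcl fun k hk => ?_)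
        obtain ⟨V, hV, e, ht⟩ := hg.exists_transition hj.1 hj.2
        rw [← e, signConj_eq]
        refine contiguousMinor_ne_zero_of_transverse ?_ hk
        set D := diagonalGL (fun i => ((ε i : ℤ) : ℝ)) fun i => unit_cast_ne_zero _ with hD
        rw [← CompleteFlag.transverse_smul_iff D, ← mul_smul]
        have : D * (D⁻¹ * V * D) = V * D := by group
        rw [this, mul_smul, hD, diagonalGL_smul_oppositeFlag]
        exact ht
      filter_upwards [hc.eventually (isClosed_closure.isOpen_compl.mem_nhds hcl)] with g' hg' _
      exact iff_of_false (fun h' => hg' (subset_closure h')) h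
  have key2 : ∀ᶠ g' in 𝓝 g, ∀ ε : Fin d → ℤˣ, ∀ j ∈ Finset.Ioo 0 m, IsTransverseFrameTuple g' →
      (IsTotallyPositiveUnipotent (signConj ε (transition g' j)) ↔
        IsTotallyPositiveUnipotent (signConj ε (transition g j))) :=
    eventually_all.2 fun ε => (Finset.eventually_all _).2 (key ε)
  filter_upwards [key2] with g' h ht
  rw [ht.isPositiveTuple_iff hm, hg.isPositiveTuple_iff hm]
  exact exists_congr fun ε => forall_congr' fun j => forall_congr' fun hj =>
    forall_congr' fun hjm => h ε j (Finset.mem_Ioo.2 ⟨hj, hjm⟩) ht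

end Lift

/-- Positivity of one member of a connected continuous family of pairwise transverse tuples implies
positivity of all. -/
theorem isPositiveTuple_of_isPreconnected {T : Type*} [TopologicalSpace T] {s : Set T}
    (hs : IsPreconnected s) {m : ℕ} (hm : 1 ≤ m) {F : T → Fin (m + 1) → CompleteFlag d}
    (hF : ∀ i, ContinuousOn (fun t => F t i) s)
    (ht : ∀ t ∈ s, ∀ i j, i ≠ j → (F t i).Transverse (F t j))
    {t₀ t₁ : T} (h₀ : t₀ ∈ s) (h₁ : t₁ ∈ s) (hpos : IsPositiveTuple (F t₀)) :
    IsPositiveTuple (F t₁) := by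
  have hq := IsOpenQuotientMap.piMap
    (fun _ : Fin (m + 1) => isOpenQuotientMap_smul_standardFlag d)
  have hloc : ∀ t ∈ s, ∀ᶠ t' in 𝓝[s] t, IsPositiveTuple (F t') ↔ IsPositiveTuple (F t) := by
    intro t hts
    obtain ⟨g, hg⟩ := hq.surjective (F t)
    have hgi : ∀ i, g i • standardFlag d = F t i := fun i => congrFun hg i
    have hgt : IsTransverseFrameTuple g := fun i j hij => by
      rw [hgi, hgi]; exact ht t hts i j hij
    have h1 : ∀ᶠ F' in 𝓝 (F t), (∀ i j, i ≠ j → (F' i).Transverse (F' j)) →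
        (IsPositiveTuple F' ↔ IsPositiveTuple (F t)) := by
      have h2 := hq.isOpenMap.image_mem_nhds (hgt.eventually_isPositiveTuple_iff hm)
      rw [hg] at h2
      filter_upwards [h2]
      rintro F' ⟨g', hg', rfl⟩ hF'
      have h3 := hg' hF'
      have h4 : (fun i => g i • standardFlag d) = F t := funext hgi
      rw [h4] at h3
      exact h3
    have hc : Tendsto F (𝓝[s] t) (𝓝 (F t)) := tendsto_pi_nhds.2 fun i => hF i t hts
    filter_upwards [hc.eventually h1, self_mem_nhdsWithin] with t' h ht's
    exact h (ht t' ht's)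
  exact (hs.induction₂ (fun t t' => IsPositiveTuple (F t') ↔ IsPositiveTuple (F t)) hloc
    (fun _ _ _ _ _ _ h h' => h'.trans h) (fun _ _ _ _ h => h.symm) h₀ h₁).2 hpos

/-! ### Dynamics of unipotent elements with a single Jordan block -/

/-- The nilpotency conditions characterizing a unipotent `g` with a single Jordan block. -/
def IsRegularUnipotent (g : GL (Fin d) ℝ) : Prop :=
  ((g : Matrix (Fin d) (Fin d) ℝ) - 1) ^ d = 0 ∧ ((g : Matrix (Fin d) (Fin d) ℝ) - 1) ^ (d - 1) ≠ 0

lemma conj_sub_one_pow (g P : GL (Fin d) ℝ) (k : ℕ) :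
    (((P⁻¹ * g * P : GL (Fin d) ℝ) : Matrix (Fin d) (Fin d) ℝ) - 1) ^ k =
      (P⁻¹ : GL (Fin d) ℝ) * ((g : Matrix (Fin d) (Fin d) ℝ) - 1) ^ k * (P : GL (Fin d) ℝ) := by
  have h : (((P⁻¹ * g * P : GL (Fin d) ℝ) : Matrix (Fin d) (Fin d) ℝ) - 1) =
      (P⁻¹ : GL (Fin d) ℝ) * ((g : Matrix (Fin d) (Fin d) ℝ) - 1) * (P : GL (Fin d) ℝ) := by
    rw [mul_sub, sub_mul, mul_one, Units.val_mul, Units.val_mul, Units.inv_mul]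
  rw [h, Units.conj_pow']

lemma IsRegularUnipotent.conj {g : GL (Fin d) ℝ} (hg : IsRegularUnipotent g) (P : GL (Fin d) ℝ) :
    IsRegularUnipotent (P⁻¹ * g * P) := by
  refine ⟨by rw [conj_sub_one_pow, hg.1]; simp, ?_⟩
  rw [conj_sub_one_pow, Ne, Units.mul_left_eq_zero, Units.mul_right_eq_zero]
  exact hg.2

lemma IsRegularUnipotent.inv {g : GL (Fin d) ℝ} (hg : IsRegularUnipotent g) :
    IsRegularUnipotent g⁻¹ := by
  have h : ((g⁻¹ : GL (Fin d) ℝ) : Matrix (Fin d) (Fin d) ℝ) - 1 =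
      (-g⁻¹ : GL (Fin d) ℝ) * ((g : Matrix (Fin d) (Fin d) ℝ) - 1) := by
    rw [mul_sub, Units.val_neg, neg_mul, Units.inv_mul, mul_one]; abel
  have hc : Commute ((-g⁻¹ : GL (Fin d) ℝ) : Matrix (Fin d) (Fin d) ℝ)
      ((g : Matrix (Fin d) (Fin d) ℝ) - 1) := by
    refine Commute.sub_right ?_ (Commute.one_right _)
    rw [Units.val_neg]
    exact Commute.neg_left (by rw [Commute, SemiconjBy, Units.inv_mul, Units.mul_inv])
  constructor
  · rw [h, hc.mul_pow, hg.1, mul_zero]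
  · rw [h, hc.mul_pow, ← Units.val_pow_eq_pow_val, Ne, Units.mul_right_eq_zero]
    exact hg.2

lemma jordanBlock_sub_one (i j : Fin d) :
    (jordanBlock d - 1) i j = if (i : ℕ) + 1 = j then 1 else 0 := by
  rw [Matrix.sub_apply, jordanBlock, Matrix.of_apply, Matrix.one_apply]
  by_cases h : i = j
  · subst h; simp
  · simp [h]

lemma isRegularUnipotent_of_conj_eq_jordanBlock (hd : 1 ≤ d) {g P : GL (Fin d) ℝ}
    (h : ((P⁻¹ * g * P : GL (Fin d) ℝ) : Matrix (Fin d) (Fin d) ℝ) = jordanBlock d) :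
    IsRegularUnipotent g := by
  have hN : ∀ i j : Fin d, j ≤ i → (jordanBlock d - 1) i j = 0 := by
    intro i j hij
    rw [jordanBlock_sub_one, if_neg (by have : (j : ℕ) ≤ i := hij; omega)]
  have hJ : IsRegularUnipotent (P⁻¹ * g * P) := by
    rw [IsRegularUnipotent, h]
    refine ⟨?_, fun h0 => ?_⟩
    · ext i j; exact pow_apply_of_strictUpper hN d i j (by omega)
    · have h1 := pow_apply_superdiagonal hN (d - 1) ⟨0, by omega⟩ ⟨d - 1, by omega⟩ (by simp)
      rw [h0, Finset.prod_eq_one] at h1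
      · simp at h1
      · intro l hl
        rw [Finset.mem_range] at hl
        rw [dif_pos (by simp; omega), jordanBlock_sub_one, if_pos rfl]
  have := hJ.conj P⁻¹
  convert this using 1
  group

lemma upper_of_smul_standardFlag_eq {U : GL (Fin d) ℝ} (h : U • standardFlag d = standardFlag d)
    (i j : Fin d) (hij : j < i) : U i j = 0 := by
  have h1 : glEquiv U (Pi.single j 1) ∈ (standardFlag d).sub j.succ := by
    rw [← h, mem_sub_smul, glEquiv_inv_apply, mem_standardFlag]
    intro l hl
    have : l ≠ j := by rintro rfl; simp at hl
    simp [this]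
  rw [mem_standardFlag] at h1
  have h2 := h1 i (by have : (j : ℕ) < i := hij; simp; omega)
  rw [glEquiv_apply, Matrix.mulVec_single_one] at h2
  exact h2

lemma upper_pow {A : Matrix (Fin d) (Fin d) ℝ} (hA : ∀ i j, j < i → A i j = 0) (k : ℕ) :
    (∀ i j, j < i → (A ^ k) i j = 0) ∧ ∀ i, (A ^ k) i i = A i i ^ k := by
  induction k with
  | zero => exact ⟨fun i j h => by simp [h.ne'], fun i => by simp⟩
  | succ k ih =>
    refine ⟨fun i j h => ?_, fun i => ?_⟩
    · rw [pow_succ, Matrix.mul_apply]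
      refine Finset.sum_eq_zero fun l _ => ?_
      by_cases hl : l < i
      · rw [ih.1 i l hl, zero_mul]
      · rw [hA l j (lt_of_lt_of_le h (not_lt.1 hl)), mul_zero]
    · rw [pow_succ, diag_mul_of_upper ih.1 hA, ih.2, pow_succ]

/-- A regular unipotent element that fixes the first of two transverse flags becomes, in a suitably
scaled adapted basis, upper triangular with ones on the diagonal and the superdiagonal. -/
lemma IsRegularUnipotent.exists_adapted_frame {g : GL (Fin d) ℝ} (hg : IsRegularUnipotent g)
    {F G : CompleteFlag d} (hF : g • F = F) (hFG : F.Transverse G) :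
    ∃ B : GL (Fin d) ℝ, B • standardFlag d = F ∧ B • oppositeFlag d = G ∧
      ∃ N : Matrix (Fin d) (Fin d) ℝ, (∀ i j, j ≤ i → N i j = 0) ∧
        (∀ i j : Fin d, (j : ℕ) = i + 1 → N i j = 1) ∧
        ((B⁻¹ * g * B : GL (Fin d) ℝ) : Matrix (Fin d) (Fin d) ℝ) = 1 + N := by
  obtain ⟨h, rfl⟩ := exists_smul_standardFlag F
  obtain ⟨h', rfl⟩ := exists_smul_standardFlag G
  rw [smul_standardFlag_eq h'] at hFG
  obtain ⟨X, hX, -, hX'⟩ := exists_unipotent_coordinate hFG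
  set B := h * X with hB
  have hBs : B • standardFlag d = h • standardFlag d := by
    rw [hB, mul_smul, smul_standardFlag_of_upper hX.1]
  set U := B⁻¹ * g * B with hU
  have hUs : U • standardFlag d = standardFlag d := by
    rw [hU, mul_smul, mul_smul, hBs, hF, ← hBs, inv_smul_smul]
  have hUr := hg.conj B
  rw [← hU] at hUr
  have hup := upper_of_smul_standardFlag_eq hUs
  set N : Matrix (Fin d) (Fin d) ℝ := U - 1 with hN
  have hNup : ∀ i j, j < i → N i j = 0 := fun i j hij => by simp [hN, hup i j hij, hij.ne']
  have hNs : ∀ i j, j ≤ i → N i j = 0 := by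
    intro i j hij
    rcases hij.eq_or_lt with rfl | hlt
    · have h1 := (upper_pow hNup d).2 j
      rw [hUr.1] at h1
      exact (pow_eq_zero_iff (by have := j.2; omega)).1 h1.symm
    · exact hNup i j hlt
  have hsup : ∀ k (hk : k + 1 < d), N ⟨k, by omega⟩ ⟨k + 1, hk⟩ ≠ 0 := by
    intro k hk h0
    refine hUr.2 ?_
    ext i j
    by_cases hij : (j : ℕ) < i + (d - 1)
    · exact pow_apply_of_strictUpper hNs _ i j hij
    · rw [pow_apply_superdiagonal hNs (d - 1) i j (by have := j.2; omega),
        Finset.prod_eq_zero (i := k) (by simp; omega)]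
      · rfl
      · have hi : (i : ℕ) = 0 := by have := j.2; omega
        simp only [hi, zero_add]
        rw [dif_pos hk, h0]
  -- scaling factors turning the superdiagonal entries into ones
  set c : ℕ → ℝ := fun k => if hk : k + 1 < d then N ⟨k, by omega⟩ ⟨k + 1, hk⟩ else 1 with hc
  have hc0 : ∀ k, c k ≠ 0 := by
    intro k
    simp only [hc]
    split_ifs with hk
    · exact hsup k hk
    · exact one_ne_zero
  set l : Fin d → ℝ := fun i => ∏ k ∈ Finset.range i, (c k)⁻¹ with hl
  have hl0 : ∀ i, l i ≠ 0 := fun i =>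
    Finset.prod_ne_zero_iff.2 fun k _ => inv_ne_zero (hc0 k)
  set D := diagonalGL l hl0 with hD
  refine ⟨B * D, ?_, ?_, Matrix.of fun i j => (l i)⁻¹ * N i j * l j, ?_, ?_, ?_⟩
  · rw [mul_smul, hD, diagonalGL_smul_standardFlag, hBs]
  · rw [mul_smul, hD, diagonalGL_smul_oppositeFlag, smul_standardFlag_eq h', hX']
  · intro i j hij
    simp [hNs i j hij]
  · intro i j hij
    have h1 : l j = l i * (N i j)⁻¹ := by
      have hcij : c i = N i j := by
        simp only [hc]
        rw [dif_pos (by rw [← hij]; exact j.2)]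
        congr; exact hij.symm
      simp only [hl]
      rw [hij, Finset.prod_range_succ, hcij]
    have h2 : N i j ≠ 0 := by
      have := hsup i (by rw [← hij]; exact j.2)
      convert this using 2
      ext; exact hij
    rw [Matrix.of_apply, h1]
    have := hl0 i
    field_simp
  · have e : (B * D)⁻¹ * g * (B * D) = D⁻¹ * U * D := by rw [hU]; group
    have hUN : (U : Matrix (Fin d) (Fin d) ℝ) = 1 + N := by rw [hN]; abel
    rw [e, hD, coe_diagonalGL_inv, Units.val_mul, Units.val_mul, coe_diagonalGL, coe_diagonalGL, hUN]
    ext i j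
    rw [Matrix.mul_diagonal, Matrix.diagonal_mul]
    by_cases hij : i = j
    · subst hij
      have := hl0 i
      simp [hNs i i le_rfl, this]
    · simp [hij]

/-- The orbit of a flag under a large power of a regular unipotent element, together with the fixed
flag of the latter, forms positive tuples. -/
theorem IsRegularUnipotent.exists_isPositiveTuple {g : GL (Fin d) ℝ} (hg : IsRegularUnipotent g)
    {F G : CompleteFlag d} (hF : g • F = F) (hFG : F.Transverse G) {m : ℕ} (hm : 1 ≤ m) :
    ∃ n : ℕ, 0 < n ∧ IsPositiveTuple (fun j : Fin (m + 1) =>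
      if (j : ℕ) = 0 then F else g ^ (n * (m - j)) • G) := by
  obtain ⟨B, hBF, hBG, N, hN, hN1, hU⟩ := hg.exists_adapted_frame hF hFG
  set U := B⁻¹ * g * B with hUd
  obtain ⟨n, hn, hn0⟩ := ((eventually_isTotallyPositiveUnipotent_pow hN hN1).and
    (eventually_gt_atTop 0)).exists
  have hUu : U ∈ upperUnipotent d := by
    constructor
    · intro i j hij
      rw [hU]
      simp [hN i j hij.le, hij.ne']
    · intro i
      rw [hU]
      simp [hN i i le_rfl]
  refine ⟨n, hn0, (isPositiveTuple_iff (g := B) (X := fun j => U ^ (n * (m - j))) hm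
    (fun j => pow_mem hUu _) (by simp [hBF]) fun j hj => ?_).2 ⟨fun _ => 1, fun j hj hjm => ?_⟩⟩
  · rw [if_neg (by omega), ← hBG, ← mul_smul]
    congr 1
    have : U = B⁻¹ * g * (B⁻¹)⁻¹ := by rw [inv_inv]
    rw [this, conj_pow]
    group
  · have h1 : (U ^ (n * (m - (j + 1))))⁻¹ * U ^ (n * (m - j)) = U ^ n := by
      have : n * (m - j) = n * (m - (j + 1)) + n := by
        rw [show m - j = m - (j + 1) + 1 by omega, mul_add, mul_one]
      rw [this, pow_add, inv_mul_cancel_left]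
    rw [h1, Units.val_pow_eq_pow_val, hU]
    convert hn using 1
    ext a b
    simp [signConj]

/-! ### Lines attracted by unipotent elements -/

lemma tendsto_pow_mulVec {N : Matrix (Fin d) (Fin d) ℝ} (hN : N ^ d = 0) {r : ℕ} {v : Fin d → ℝ}
    (hr : r < d) (hv : (N ^ (r + 1)).mulVec v = 0) :
    Tendsto (fun n : ℕ => ((n : ℝ) ^ r)⁻¹ • ((1 + N) ^ n).mulVec v) atTop
      (𝓝 ((r.factorial : ℝ)⁻¹ • (N ^ r).mulVec v)) := by
  have h1 : Tendsto (fun n : ℕ => ∑ m ∈ Finset.range d,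
      ((n.choose m : ℝ) / (n : ℝ) ^ r) • (N ^ m).mulVec v) atTop
      (𝓝 (∑ m ∈ Finset.range d, if m = r then (r.factorial : ℝ)⁻¹ • (N ^ r).mulVec v else 0)) := by
    refine tendsto_finsetSum _ fun m _ => ?_
    rcases lt_trichotomy m r with h | h | h
    · rw [if_neg h.ne]
      simpa using (tendsto_choose_div_pow_of_lt h).smul_const ((N ^ m).mulVec v)
    · subst h
      simpa using (tendsto_choose_div_pow m).smul_const ((N ^ m).mulVec v)
    · obtain ⟨s, rfl⟩ : ∃ s, m = s + (r + 1) := ⟨m - (r + 1), by omega⟩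
      rw [if_neg h.ne', pow_add, ← Matrix.mulVec_mulVec, hv]
      simp
  rw [Finset.sum_ite_eq', if_pos (by simpa using hr)] at h1
  refine h1.congr fun n => ?_
  rw [one_add_pow_eq_sum hN, Matrix.sum_mulVec, Finset.smul_sum]
  refine Finset.sum_congr rfl fun m _ => ?_
  rw [Matrix.smul_mulVec, ← Nat.cast_smul_eq_nsmul ℝ, smul_smul, div_eq_mul_inv, mul_comm]

lemma tendsto_norm_div_norm {N : Matrix (Fin d) (Fin d) ℝ} (hN : N ^ d = 0) {v : Fin d → ℝ}
    (hv : v ≠ 0) : Tendsto (fun n : ℕ => ‖N.mulVec (((1 + N) ^ n).mulVec v)‖ /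
      ‖((1 + N) ^ n).mulVec v‖) atTop (𝓝 0) := by
  classical
  have hex : ∃ r, (N ^ (r + 1)).mulVec v = 0 := ⟨d, by rw [pow_succ, hN]; simp⟩
  set r := Nat.find hex with hrd
  have hr1 : (N ^ (r + 1)).mulVec v = 0 := Nat.find_spec hex
  have hr0 : (N ^ r).mulVec v ≠ 0 := by
    rcases Nat.eq_zero_or_pos r with h | h
    · rw [h]; simpa using hv
    · have := Nat.find_min hex (m := r - 1) (by omega)
      rwa [Nat.sub_add_cancel h] at this
  have hrd : r < d := by
    by_contra h
    refine hr0 ?_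
    rw [← Nat.sub_add_cancel (not_lt.1 h), pow_add, hN]; simp
  have h1 := tendsto_pow_mulVec hN hrd hr1
  have h2 := tendsto_pow_mulVec hN (v := N.mulVec v) hrd (by
    rw [Matrix.mulVec_mulVec, ← pow_succ, pow_succ', ← Matrix.mulVec_mulVec, hr1,
      Matrix.mulVec_zero])
  rw [Matrix.mulVec_mulVec, ← pow_succ, hr1, smul_zero] at h2
  have h3 := h2.norm.div h1.norm (by
    rw [norm_ne_zero_iff]
    exact smul_ne_zero (by positivity) hr0)
  rw [norm_zero, zero_div] at h3
  refine h3.congr' ?_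
  filter_upwards [eventually_gt_atTop 0] with n hn
  have hn0 : ((n : ℝ) ^ r)⁻¹ ≠ 0 := by positivity
  have hcomm : N * (1 + N) ^ n = (1 + N) ^ n * N :=
    ((Commute.one_right N).add_right (Commute.refl N)).pow_right n
  rw [Pi.div_apply, norm_smul, norm_smul, mul_div_mul_left _ _ (norm_ne_zero_iff.2 hn0),
    Matrix.mulVec_mulVec, Matrix.mulVec_mulVec, hcomm]

/-- The one-dimensional subspace of a complete flag. -/
def CompleteFlag.line (hd : 1 ≤ d) (F : CompleteFlag d) : Submodule ℝ (Fin d → ℝ) :=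
  F.sub ⟨1, by omega⟩

lemma CompleteFlag.exists_line_ne_zero (hd : 1 ≤ d) (F : CompleteFlag d) :
    ∃ v ∈ F.line hd, v ≠ 0 := by
  refine (Submodule.ne_bot_iff _).1 fun h => ?_
  have := F.finrank_sub ⟨1, by omega⟩
  rw [show F.sub ⟨1, by omega⟩ = ⊥ from h] at this
  simp at this

/-- The factor by which `N` stretches the line of a flag, computed with any nonzero vector on it. -/
noncomputable def lineStretch (hd : 1 ≤ d) (N : Matrix (Fin d) (Fin d) ℝ) (F : CompleteFlag d) : ℝ :=
  ‖N.mulVec (F.exists_line_ne_zero hd).choose‖ / ‖(F.exists_line_ne_zero hd).choose‖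

lemma lineStretch_eq (hd : 1 ≤ d) (N : Matrix (Fin d) (Fin d) ℝ) {F : CompleteFlag d}
    {v : Fin d → ℝ} (hv : v ∈ F.line hd) (hv0 : v ≠ 0) :
    lineStretch hd N F = ‖N.mulVec v‖ / ‖v‖ := by
  unfold lineStretch
  obtain ⟨hw, hw0⟩ := (F.exists_line_ne_zero hd).choose_spec
  set w := (F.exists_line_ne_zero hd).choose
  have h1 : Module.finrank ℝ (F.line hd) = 1 := F.finrank_sub ⟨1, by omega⟩
  obtain ⟨c, hc⟩ := (finrank_eq_one_iff_of_nonzero' (⟨v, hv⟩ : F.line hd)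
    (by simpa using hv0)).1 h1 ⟨w, hw⟩
  have hc' : c • v = w := congrArg Subtype.val hc
  have hc0 : c ≠ 0 := by rintro rfl; rw [zero_smul] at hc'; exact hw0 hc'.symm
  rw [← hc', Matrix.mulVec_smul, norm_smul, norm_smul, mul_div_mul_left _ _ (norm_ne_zero_iff.2 hc0)]

lemma continuous_lineStretch (hd : 1 ≤ d) (N : Matrix (Fin d) (Fin d) ℝ) :
    Continuous (lineStretch hd N) := by
  refine continuous_coinduced_dom.2 ?_
  have h0 : ∀ g : GL (Fin d) ℝ, glEquiv g (Pi.single ⟨0, by omega⟩ 1) ≠ 0 := fun g h => by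
    rw [map_eq_zero_iff _ (LinearEquiv.injective _)] at h
    simp at h
  have h1 : ∀ g : GL (Fin d) ℝ, lineStretch hd N (g • standardFlag d) =
      ‖N.mulVec (glEquiv g (Pi.single ⟨0, by omega⟩ 1))‖ /
        ‖glEquiv g (Pi.single ⟨0, by omega⟩ 1)‖ := by
    intro g
    refine lineStretch_eq hd N ?_ (h0 g)
    rw [CompleteFlag.line, mem_sub_smul, glEquiv_inv_apply, mem_standardFlag]
    intro i hi
    have : i ≠ ⟨0, by omega⟩ := fun h => by rw [h] at hi; simp at hi
    simp [this]
  have h2 : Continuous fun g : GL (Fin d) ℝ => glEquiv g (Pi.single ⟨0, by omega⟩ 1) := by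
    simp only [glEquiv_apply]
    exact Units.continuous_val.matrix_mulVec continuous_const
  have h3 := ((continuous_const (y := N)).matrix_mulVec h2).norm.div h2.norm
    fun g => norm_ne_zero_iff.2 (h0 g)
  exact h3.congr fun g => (h1 g).symm

/-- A flag accumulated by the forward orbit of a flag under a unipotent `g` has its line in the
kernel of `g - 1`. -/
lemma mulVec_eq_zero_of_mapClusterPt (hd : 1 ≤ d) {g : GL (Fin d) ℝ}
    (hg : ((g : Matrix (Fin d) (Fin d) ℝ) - 1) ^ d = 0) {F G : CompleteFlag d}
    (hG : MapClusterPt G atTop fun n : ℕ => g ^ n • F) {v : Fin d → ℝ} (hv : v ∈ G.line hd) :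
    ((g : Matrix (Fin d) (Fin d) ℝ) - 1).mulVec v = 0 := by
  by_cases hv0 : v = 0
  · rw [hv0, Matrix.mulVec_zero]
  set N := (g : Matrix (Fin d) (Fin d) ℝ) - 1 with hN
  have hgN : (g : Matrix (Fin d) (Fin d) ℝ) = 1 + N := by rw [hN]; abel
  have h1 := hG.continuousAt_comp (continuous_lineStretch hd N).continuousAt
  obtain ⟨w, hw, hw0⟩ := F.exists_line_ne_zero hd
  have h2 : Tendsto (lineStretch hd N ∘ fun n : ℕ => g ^ n • F) atTop (𝓝 0) := by
    refine (tendsto_norm_div_norm hg hw0).congr fun n => ?_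
    have e : glEquiv (g ^ n) w = ((1 + N) ^ n).mulVec w := by
      rw [glEquiv_apply, Units.val_pow_eq_pow_val, hgN]
    rw [Function.comp, lineStretch_eq hd N (v := glEquiv (g ^ n) w), e]
    · rw [CompleteFlag.line, mem_sub_smul, glEquiv_inv_apply]; exact hw
    · rwa [Ne, map_eq_zero_iff _ (LinearEquiv.injective _)]
  have h3 : lineStretch hd N G = 0 := eq_of_nhds_neBot (ClusterPt.mono h1 h2)
  rw [lineStretch_eq hd N hv hv0, div_eq_zero_iff] at h3
  rcases h3 with h3 | h3
  · simpa using h3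
  · exact absurd (norm_eq_zero.1 h3) hv0

/-- Two flags whose lines are fixed pointwise by a unipotent with a single Jordan block share their
lines, hence are not transverse. -/
lemma not_transverse_of_line_fixed (hd : 2 ≤ d) {g P : GL (Fin d) ℝ}
    (h : ((P⁻¹ * g * P : GL (Fin d) ℝ) : Matrix (Fin d) (Fin d) ℝ) = jordanBlock d)
    {F G : CompleteFlag d}
    (hF : ∀ v ∈ F.line (by omega), ((g : Matrix (Fin d) (Fin d) ℝ) - 1).mulVec v = 0)
    (hG : ∀ v ∈ G.line (by omega), ((g : Matrix (Fin d) (Fin d) ℝ) - 1).mulVec v = 0) :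
    ¬ F.Transverse G := by
  have key : ∀ H : CompleteFlag d,
      (∀ v ∈ H.line (by omega), ((g : Matrix (Fin d) (Fin d) ℝ) - 1).mulVec v = 0) →
      H.line (by omega) = (P • standardFlag d).line (by omega) := by
    intro H hH
    refine Submodule.eq_of_le_of_finrank_eq (fun v hv => ?_)
      (by rw [CompleteFlag.line, CompleteFlag.line, CompleteFlag.finrank_sub,
        CompleteFlag.finrank_sub])
    rw [CompleteFlag.line, mem_sub_smul, mem_standardFlag]
    intro i hi
    simp only at hi
    have h1 : (jordanBlock d - 1).mulVec (glEquiv P⁻¹ v) = 0 := by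
      have h2 := conj_sub_one_pow g P 1
      rw [pow_one, pow_one, h] at h2
      rw [h2, ← Matrix.mulVec_mulVec, ← glEquiv_apply P, glEquiv_apply_inv, ← Matrix.mulVec_mulVec,
        hH v hv, Matrix.mulVec_zero]
    have h3 := congrFun h1 ⟨i - 1, by omega⟩
    simp only [Matrix.mulVec, dotProduct, jordanBlock_sub_one] at h3
    rw [Finset.sum_eq_single i] at h3
    · rw [if_pos (by omega), one_mul] at h3
      exact h3
    · intro j _ hj
      rw [if_neg (fun h' => hj (by ext; omega)), zero_mul]
    · simp
  intro ht
  obtain ⟨v, hv, hv0⟩ := F.exists_line_ne_zero (by omega)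
  refine hv0 (ht.eq_zero ⟨1, by omega⟩ hv (G.mono ?_ (?_ : v ∈ G.line (by omega))))
  · rw [Fin.le_def]; simp; omega
  · rw [key G hG, ← key F hF]; exact hv

/-! ### Angular coordinates on the circle -/

lemma mk_smul_boundary (g : GL (Fin 2) ℝ) (x : OnePoint ℝ) :
    (Matrix.ProjGenLinGroup.mk g : PGL(Fin 2, ℝ)) • x = g • x := rfl

/-- The rotation of the circle `ℝ ∪ {∞}` by the angle `θ`; it has period `π`. -/
noncomputable def rotation (θ : ℝ) : GL (Fin 2) ℝ :=
  Matrix.GeneralLinearGroup.mkOfDetNeZero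
    !![Real.cos θ, Real.sin θ; -Real.sin θ, Real.cos θ]
    (by
      rw [Matrix.det_fin_two_of]
      have := Real.sin_sq_add_cos_sq θ
      nlinarith)

lemma coe_rotation (θ : ℝ) : (rotation θ : Matrix (Fin 2) (Fin 2) ℝ) =
    !![Real.cos θ, Real.sin θ; -Real.sin θ, Real.cos θ] := rfl

lemma rotation_add (a b : ℝ) : rotation (a + b) = rotation a * rotation b := by
  refine Units.ext ?_
  rw [Units.val_mul, coe_rotation, coe_rotation, coe_rotation, Real.cos_add, Real.sin_add]
  ext i j
  fin_cases i <;> fin_cases j <;> simp [Matrix.mul_apply, Fin.sum_univ_two] <;> ring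

/-- The point `-cot θ` of the circle `ℝ ∪ {∞}`, obtained from `∞` by the rotation of angle `θ`. It
moves upwards through `ℝ` when `θ` increases from `0` to `π`. -/
noncomputable def circlePoint (θ : ℝ) : OnePoint ℝ := rotation θ • (OnePoint.infty : OnePoint ℝ)

lemma circlePoint_eq (θ : ℝ) : circlePoint θ =
    if Real.sin θ = 0 then OnePoint.infty else ((-(Real.cos θ / Real.sin θ) : ℝ) : OnePoint ℝ) := by
  rw [circlePoint, OnePoint.smul_infty_eq_ite, coe_rotation]
  simp [div_neg]

lemma circlePoint_add (a b : ℝ) : circlePoint (a + b) = rotation a • circlePoint b := by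
  rw [circlePoint, rotation_add, mul_smul, circlePoint]

lemma sin_eq_zero_of_circlePoint_eq {a b : ℝ} (h : circlePoint a = circlePoint b) :
    Real.sin (b - a) = 0 := by
  have h1 : circlePoint (-a + b) = circlePoint (-a + a) := by
    rw [circlePoint_add, circlePoint_add, h]
  rw [neg_add_cancel, neg_add_eq_sub, circlePoint_eq, circlePoint_eq 0] at h1
  by_contra h2
  simp [h2] at h1

lemma circlePoint_ne {a b : ℝ} (h1 : a < b) (h2 : b < a + Real.pi) :
    circlePoint a ≠ circlePoint b := fun h =>
  (Real.sin_pos_of_pos_of_lt_pi (by linarith) (by linarith) : 0 < Real.sin (b - a)).ne'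
    (sin_eq_zero_of_circlePoint_eq h)

lemma continuous_circlePoint : Continuous circlePoint := by
  rw [continuous_iff_continuousAt]
  intro θ
  by_cases hθ : Real.sin θ = 0
  · have e : circlePoint θ = OnePoint.infty := by rw [circlePoint_eq, if_pos hθ]
    rw [ContinuousAt, e]
    have hcos : Real.cos θ ≠ 0 := by
      intro h
      have := Real.sin_sq_add_cos_sq θ
      rw [h, hθ] at this
      norm_num at this
    have h1 : Tendsto (fun t => -(Real.cos t / Real.sin t)) (𝓝[{t | Real.sin t ≠ 0}] θ)
        (cocompact ℝ) := by
      rw [← Metric.cobounded_eq_cocompact, ← tendsto_norm_atTop_iff_cobounded]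
      have h2 : Tendsto (fun t => ‖Real.sin t‖⁻¹) (𝓝[{t | Real.sin t ≠ 0}] θ) atTop := by
        refine tendsto_inv_nhdsGT_zero.comp (tendsto_nhdsWithin_iff.2 ⟨?_, ?_⟩)
        · have : Tendsto (fun t => ‖Real.sin t‖) (𝓝 θ) (𝓝 ‖Real.sin θ‖) :=
            Real.continuous_sin.norm.continuousAt
          rw [hθ, norm_zero] at this
          exact this.mono_left nhdsWithin_le_nhds
        · filter_upwards [self_mem_nhdsWithin] with t ht
          exact norm_pos_iff.2 ht
      have h3 : Tendsto (fun t => ‖Real.cos t‖) (𝓝[{t | Real.sin t ≠ 0}] θ) (𝓝 ‖Real.cos θ‖) :=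
        (Real.continuous_cos.norm.continuousAt (x := θ)).mono_left nhdsWithin_le_nhds
      refine (h3.pos_mul_atTop (norm_pos_iff.2 hcos) h2).congr fun t => ?_
      rw [norm_neg, norm_div, div_eq_mul_inv]
    intro s hs
    rw [OnePoint.nhds_infty_eq, mem_sup, mem_pure, mem_map, coclosedCompact_eq_cocompact] at hs
    have h4 := mem_nhdsWithin_iff_eventually.1 (h1 hs.1)
    rw [mem_map]
    filter_upwards [h4] with t ht
    rw [Set.mem_preimage, circlePoint_eq]
    split_ifs with h
    · exact hs.2
    · exact ht h
  · have h1 : ContinuousAt (fun t => ((-(Real.cos t / Real.sin t) : ℝ) : OnePoint ℝ)) θ := by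
      refine OnePoint.continuous_coe.continuousAt.comp ?_
      exact (Real.continuous_cos.continuousAt.div Real.continuous_sin.continuousAt hθ).neg
    refine h1.congr ?_
    filter_upwards [Real.continuous_sin.continuousAt.eventually_ne hθ] with t ht
    rw [circlePoint_eq, if_neg ht]

/-- The angle in `(0, π]` of a point of the circle `ℝ ∪ {∞}`. -/
noncomputable def angle (x : OnePoint ℝ) : ℝ :=
  x.elim Real.pi fun r => Real.pi / 2 + Real.arctan r

@[simp] lemma angle_infty : angle OnePoint.infty = Real.pi := rfl

@[simp] lemma angle_coe (r : ℝ) : angle (r : OnePoint ℝ) = Real.pi / 2 + Real.arctan r := rfl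

lemma angle_coe_lt_pi (r : ℝ) : angle (r : OnePoint ℝ) < Real.pi := by
  have := Real.arctan_lt_pi_div_two r
  simp; linarith

lemma angle_pos (x : OnePoint ℝ) : 0 < angle x := by
  induction x using OnePoint.rec with
  | infty => simpa using Real.pi_pos
  | coe r =>
    have := Real.neg_pi_div_two_lt_arctan r
    simp; linarith

lemma angle_le_pi (x : OnePoint ℝ) : angle x ≤ Real.pi := by
  induction x using OnePoint.rec with
  | infty => simp
  | coe r => exact (angle_coe_lt_pi r).le

lemma circlePoint_angle (x : OnePoint ℝ) : circlePoint (angle x) = x := by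
  induction x using OnePoint.rec with
  | infty => simp [circlePoint_eq]
  | coe r =>
    have hc : Real.cos (Real.arctan r) ≠ 0 := (Real.cos_arctan_pos r).ne'
    have h1 : Real.sin (Real.pi / 2 + Real.arctan r) = Real.cos (Real.arctan r) := by
      rw [add_comm, Real.sin_add_pi_div_two]
    have h2 : Real.cos (Real.pi / 2 + Real.arctan r) = -Real.sin (Real.arctan r) := by
      rw [add_comm, Real.cos_add_pi_div_two]
    rw [angle_coe, circlePoint_eq, h1, if_neg hc, h2, neg_div, neg_neg, ← Real.tan_eq_sin_div_cos,
      Real.tan_arctan]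

lemma circlePoint_add_pi (θ : ℝ) : circlePoint (θ + Real.pi) = circlePoint θ := by
  rw [circlePoint_eq, circlePoint_eq, Real.sin_add_pi, Real.cos_add_pi]
  simp [neg_div_neg_eq]

lemma angle_lt_angle {x y : OnePoint ℝ}
    (h : (x.elim ⊤ fun r => (r : WithTop ℝ)) < y.elim ⊤ fun r => (r : WithTop ℝ)) :
    angle x < angle y := by
  induction x using OnePoint.rec with
  | infty => exact absurd h not_top_lt
  | coe r =>
    induction y using OnePoint.rec with
    | infty => exact angle_coe_lt_pi r
    | coe s =>
      have h' : r < s := WithTop.coe_lt_coe.1 h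
      have := Real.arctan_strictMono h'
      simpa using this

/-- The lifts to the line of the cyclically ordered tuples of the circle `ℝ / π`: increasing tuples of
length less than `π`. They form a convex set. -/
def cyclicLifts (m : ℕ) : Set (Fin (m + 1) → ℝ) :=
  {θ | StrictMono θ ∧ θ (Fin.last m) < θ 0 + Real.pi}

lemma convex_cyclicLifts (m : ℕ) : Convex ℝ (cyclicLifts m) := by
  have key : ∀ {a b p q r s : ℝ}, 0 ≤ a → 0 ≤ b → a + b = 1 → p < q → r < s →
      a * p + b * r < a * q + b * s := by
    intro a b p q r s ha hb hab h1 h2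
    rcases ha.eq_or_lt with rfl | ha'
    · obtain rfl : b = 1 := by linarith
      linarith
    · nlinarith
  rintro x ⟨hx, hx'⟩ y ⟨hy, hy'⟩ a b ha hb hab
  refine ⟨fun i j hij => key ha hb hab (hx hij) (hy hij), ?_⟩
  have := key ha hb hab hx' hy'
  simp only [Pi.add_apply, Pi.smul_apply, smul_eq_mul]
  calc _ < _ := this
    _ = a * x 0 + b * y 0 + (a + b) * Real.pi := by ring
    _ = _ := by rw [hab, one_mul]

lemma circlePoint_ne_of_mem_cyclicLifts {m : ℕ} {θ : Fin (m + 1) → ℝ} (hθ : θ ∈ cyclicLifts m)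
    {i j : Fin (m + 1)} (hij : i ≠ j) : circlePoint (θ i) ≠ circlePoint (θ j) := by
  have key : ∀ i j : Fin (m + 1), i < j → circlePoint (θ i) ≠ circlePoint (θ j) := by
    intro i j hij
    have h1 := hθ.1.monotone (Fin.le_last j)
    have h2 := hθ.1.monotone (Fin.zero_le i)
    exact circlePoint_ne (hθ.1 hij) (by linarith [hθ.2])
  rcases lt_or_gt_of_ne hij with h | h
  · exact key i j h
  · exact (key j i h).symm

lemma IsCyclicallyOrdered.exists_lift {m : ℕ} (hm : 2 ≤ m) {x : Fin (m + 1) → OnePoint ℝ}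
    (hx : IsCyclicallyOrdered x) : ∃ θ ∈ cyclicLifts m, ∀ i, circlePoint (θ i) = x i := by
  -- shift by `π` the points that come before `x 0` on the circle cut open at `∞`
  have hπ := Real.pi_pos
  let θ : Fin (m + 1) → ℝ := fun i =>
    if angle (x 0) ≤ angle (x i) then angle (x i) else angle (x i) + Real.pi
  have hcyc : ∀ i j k : Fin (m + 1), i < j → j < k →
      (angle (x i) < angle (x j) ∧ angle (x j) < angle (x k)) ∨
      (angle (x j) < angle (x k) ∧ angle (x k) < angle (x i)) ∨
      (angle (x k) < angle (x i) ∧ angle (x i) < angle (x j)) := by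
    intro i j k hij hjk
    rcases hx i j k hij hjk with ⟨h1, h2⟩ | ⟨h1, h2⟩ | ⟨h1, h2⟩
    · exact Or.inl ⟨angle_lt_angle h1, angle_lt_angle h2⟩
    · exact Or.inr (Or.inl ⟨angle_lt_angle h1, angle_lt_angle h2⟩)
    · exact Or.inr (Or.inr ⟨angle_lt_angle h1, angle_lt_angle h2⟩)
  have hne : ∀ j : Fin (m + 1), 0 < j → angle (x 0) ≠ angle (x j) := by
    intro j hj h
    rcases (Fin.le_last j).eq_or_lt with rfl | hlt
    · have h1 := hcyc 0 ⟨1, by omega⟩ (Fin.last m) (by simp [Fin.lt_def])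
        (by simp [Fin.lt_def]; omega)
      rcases h1 with h1 | h1 | h1 <;> linarith [h1.1, h1.2]
    · have h1 := hcyc 0 j (Fin.last m) hj hlt
      rcases h1 with h1 | h1 | h1 <;> linarith [h1.1, h1.2]
  have hpos := fun i => angle_pos (x i)
  have hle := fun i => angle_le_pi (x i)
  refine ⟨θ, ⟨fun i j hij => ?_, ?_⟩, fun i => ?_⟩
  · simp only [θ]
    rcases (Fin.zero_le i).eq_or_lt with rfl | hi
    · have h1 := hne j hij
      have := hpos j
      have := hle 0
      rw [if_pos le_rfl]
      split_ifs with h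
      · exact lt_of_le_of_ne h h1
      · linarith
    · have := hpos j
      have := hle i
      rcases hcyc 0 i j hi hij with ⟨h1, h2⟩ | ⟨h1, h2⟩ | ⟨h1, h2⟩
      · rw [if_pos h1.le, if_pos (h1.trans h2).le]; exact h2
      · rw [if_neg (not_le.2 h2), if_neg (not_le.2 (h1.trans h2))]; linarith
      · rw [if_pos h2.le, if_neg (not_le.2 h1)]; linarith
  · simp only [θ]
    have := hle (Fin.last m)
    have := hpos 0
    rw [if_pos le_rfl]
    split_ifs with h <;> linarith
  · simp only [θ]
    split_ifs
    · exact circlePoint_angle _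
    · rw [circlePoint_add_pi, circlePoint_angle]

/-- A continuous transverse map of the circle is positive as soon as, for each `m ≥ 2`, it sends one
cyclically ordered tuple of `m + 1` points to a positive one. -/
theorem isPositiveMap_of_exists {ξ : OnePoint ℝ → CompleteFlag d} (hc : Continuous ξ)
    (ht : ∀ x y, x ≠ y → (ξ x).Transverse (ξ y))
    (hex : ∀ m, 2 ≤ m → ∃ θ ∈ cyclicLifts m, IsPositiveTuple fun i => ξ (circlePoint (θ i))) :
    IsPositiveMap Set.univ ξ := by
  intro m hm x _ hx
  obtain ⟨θ₁, h₁, hθ₁⟩ := hx.exists_lift hm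
  obtain ⟨θ₀, h₀, hpos⟩ := hex m hm
  have h := isPositiveTuple_of_isPreconnected (convex_cyclicLifts m).isPreconnected (by omega)
    (F := fun θ i => ξ (circlePoint (θ i)))
    (fun i => (hc.comp (continuous_circlePoint.comp (continuous_apply i))).continuousOn)
    (fun θ hθ i j hij => ht _ _ (circlePoint_ne_of_mem_cyclicLifts hθ hij)) h₀ h₁ hpos
  simpa only [hθ₁] using h

/-! ### From a unipotent element to positivity -/

variable {ξ : OnePoint ℝ → CompleteFlag d} {γ : PGL(Fin 2, ℝ)} {g : GL (Fin d) ℝ}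

lemma map_pow_smul (hξ : ∀ x, ξ (γ • x) = g • ξ x) (n : ℕ) (x : OnePoint ℝ) :
    ξ (γ ^ n • x) = g ^ n • ξ x := by
  induction n with
  | zero => simp
  | succ n ih => rw [pow_succ', pow_succ', mul_smul, mul_smul, hξ, ih]

/-- If `ξ` intertwines a translation towards `-∞` in an affine chart of the circle with a regular
unipotent element, then it sends the centre of the chart and some points of an orbit to a positive
tuple of flags. -/
lemma exists_isPositiveTuple_of_translation (hg : IsRegularUnipotent g)
    (hξ : ∀ x, ξ (γ • x) = g • ξ x) (ht : ∀ x y, x ≠ y → (ξ x).Transverse (ξ y)) {α β : ℝ}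
    (hβ : β < 0) (hp : γ • circlePoint α = circlePoint α)
    (hγ : ∀ t : ℝ, γ • rotation α • (t : OnePoint ℝ) = rotation α • ((t + β : ℝ) : OnePoint ℝ))
    {m : ℕ} (hm : 1 ≤ m) :
    ∃ θ ∈ cyclicLifts m, IsPositiveTuple fun i => ξ (circlePoint (θ i)) := by
  have hpt : ∀ t : ℝ, circlePoint (α + angle (t : OnePoint ℝ)) = rotation α • (t : OnePoint ℝ) :=
    fun t => by rw [circlePoint_add, circlePoint_angle]
  have hF : g • ξ (circlePoint α) = ξ (circlePoint α) := by rw [← hξ, hp]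
  -- the origin of the chart serves as the point whose orbit is followed
  have hne : circlePoint α ≠ rotation α • ((0 : ℝ) : OnePoint ℝ) := by
    rw [← hpt]
    exact circlePoint_ne (by linarith [angle_pos ((0 : ℝ) : OnePoint ℝ)])
      (by linarith [angle_coe_lt_pi 0])
  obtain ⟨n, hn, hpos⟩ := hg.exists_isPositiveTuple hF (ht _ _ hne) hm
  have hpow : ∀ k : ℕ, γ ^ k • rotation α • ((0 : ℝ) : OnePoint ℝ) =
      rotation α • ((k * β : ℝ) : OnePoint ℝ) := by
    intro k
    induction k with
    | zero => simp
    | succ k ih => rw [pow_succ', mul_smul, ih, hγ]; push_cast; ring_nf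
  refine ⟨fun j => if (j : ℕ) = 0 then α else α + angle (((n * (m - j) : ℕ) * β : ℝ) : OnePoint ℝ),
    ⟨fun i j hij => ?_, ?_⟩, ?_⟩
  · have hij' : (i : ℕ) < j := hij
    simp only
    rw [if_neg (show (j : ℕ) ≠ 0 by omega)]
    split_ifs with hi
    · linarith [angle_pos (((n * (m - j) : ℕ) * β : ℝ) : OnePoint ℝ)]
    · have h1 : n * (m - j) < n * (m - i) := Nat.mul_lt_mul_of_pos_left (by omega) hn
      have h2 : ((n * (m - j) : ℕ) : ℝ) < (n * (m - i) : ℕ) := by exact_mod_cast h1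
      have h3 := Real.arctan_strictMono (mul_lt_mul_of_neg_right h2 hβ)
      simp only [angle_coe]
      linarith
  · simp only [Fin.val_last, Fin.val_zero, if_true]
    rw [if_neg (by omega)]
    linarith [angle_coe_lt_pi ((n * (m - m) : ℕ) * β : ℝ)]
  · convert hpos using 2 with j
    beta_reduce
    split_ifs with hj
    · rfl
    · rw [hpt, ← hpow, map_pow_smul hξ]

/-- An element of `PGL(2, ℝ)` with a single fixed point on the circle is a translation in an affine
chart centred at this point. -/
lemma exists_translation {p : OnePoint ℝ} (hp : γ • p = p) (hu : ∀ q, γ • q = q → q = p) :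
    ∃ α β : ℝ, circlePoint α = p ∧ β ≠ 0 ∧ ∀ t : ℝ,
      γ • rotation α • (t : OnePoint ℝ) = rotation α • ((t + β : ℝ) : OnePoint ℝ) := by
  obtain ⟨A, rfl⟩ := Matrix.ProjGenLinGroup.mk_surjective γ
  simp only [mk_smul_boundary] at hp hu ⊢
  set α := angle p
  have hα : circlePoint α = p := circlePoint_angle p
  set A' := (rotation α)⁻¹ * A * rotation α with hA'
  have hconj : ∀ x : OnePoint ℝ, A • rotation α • x = rotation α • A' • x := fun x => by
    rw [hA', mul_smul, mul_smul, smul_inv_smul]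
  have hnofix : ∀ t : ℝ, A' • (t : OnePoint ℝ) ≠ t := by
    intro t h
    have h1 := hu (rotation α • (t : OnePoint ℝ)) (by rw [hconj, h])
    rw [← hα, circlePoint, smul_left_cancel_iff] at h1
    exact OnePoint.coe_ne_infty t h1
  have hc : A' 1 0 = 0 := by
    rw [← OnePoint.smul_infty_eq_self_iff]
    refine smul_left_cancel (rotation α) ?_
    rw [← hconj, ← circlePoint, hα, hp]
  have hdet := A'.det.ne_zero
  rw [Matrix.GeneralLinearGroup.val_det_apply, Matrix.det_fin_two, hc, mul_zero, sub_zero] at hdet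
  have hd1 : A' 1 1 ≠ 0 := right_ne_zero_of_mul hdet
  have hsmul : ∀ t : ℝ, A' • (t : OnePoint ℝ) =
      (((A' 0 0 * t + A' 0 1) / A' 1 1 : ℝ) : OnePoint ℝ) := by
    intro t
    rw [OnePoint.smul_some_eq_ite, hc, zero_mul, zero_add, if_neg hd1]
  -- a slope different from `1` would create a second fixed point
  have heq : A' 0 0 = A' 1 1 := by
    by_contra hne
    refine hnofix (A' 0 1 / (A' 1 1 - A' 0 0)) ?_
    rw [hsmul]
    congr 1
    have := sub_ne_zero.2 (Ne.symm hne)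
    field_simp
    ring
  refine ⟨α, A' 0 1 / A' 1 1, hα, fun h0 => hnofix 0 ?_, fun t => ?_⟩
  · rw [hsmul, mul_zero, zero_add, h0]
  · rw [hconj, hsmul, heq]
    congr 2
    field_simp

/-- A continuous transverse map that intertwines `γ` with a unipotent element with a single Jordan
block forces `γ` to be parabolic: the orbits of `γ` accumulate at its only fixed point. -/
lemma exists_unique_fixedPoint (hd : 2 ≤ d) (hc : Continuous ξ)
    (ht : ∀ x y, x ≠ y → (ξ x).Transverse (ξ y)) (hξ : ∀ x, ξ (γ • x) = g • ξ x)
    {P : GL (Fin d) ℝ}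
    (h : ((P⁻¹ * g * P : GL (Fin d) ℝ) : Matrix (Fin d) (Fin d) ℝ) = jordanBlock d) :
    ∃ p : OnePoint ℝ, γ • p = p ∧ ∀ q : OnePoint ℝ, γ • q = q → q = p := by
  have hg := isRegularUnipotent_of_conj_eq_jordanBlock (by omega) h
  -- at most one point of the circle is mapped to a flag whose line is fixed pointwise by `g`
  have huniq : ∀ x y, (∀ v ∈ (ξ x).line (by omega),
      ((g : Matrix (Fin d) (Fin d) ℝ) - 1).mulVec v = 0) →
      (∀ v ∈ (ξ y).line (by omega), ((g : Matrix (Fin d) (Fin d) ℝ) - 1).mulVec v = 0) →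
      x = y := by
    intro x y hx hy
    by_contra hne
    exact not_transverse_of_line_fixed hd h hx hy (ht x y hne)
  obtain ⟨p, hp⟩ : ∃ p, MapClusterPt p atTop fun n : ℕ => γ ^ n • (OnePoint.infty : OnePoint ℝ) :=
    exists_clusterPt_of_compactSpace _
  have h1 := hp.continuousAt_comp hc.continuousAt
  have h2 : MapClusterPt (ξ p) atTop fun n : ℕ => g ^ n • ξ OnePoint.infty := by
    simpa only [Function.comp_def, map_pow_smul hξ] using h1
  have hline : ∀ v ∈ (ξ p).line (by omega), ((g : Matrix (Fin d) (Fin d) ℝ) - 1).mulVec v = 0 :=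
    fun v hv => mulVec_eq_zero_of_mapClusterPt (by omega) hg.1 h2 hv
  refine ⟨p, huniq _ _ (fun v hv => ?_) hline, fun q hq => huniq _ _ (fun v hv => ?_) hline⟩
  · -- `g` fixes the line of `ξ p` pointwise, hence preserves it
    rw [hξ, CompleteFlag.line, mem_sub_smul] at hv
    have h3 := hline _ hv
    rw [Matrix.sub_mulVec, Matrix.one_mulVec, ← glEquiv_apply, glEquiv_apply_inv, sub_eq_zero] at h3
    rw [h3]
    exact hline _ hv
  · have h4 : ∀ n : ℕ, g ^ n • ξ q = ξ q := by
      intro n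
      induction n with
      | zero => simp
      | succ n ih => rw [pow_succ', mul_smul, ih, ← hξ, hq]
    refine mulVec_eq_zero_of_mapClusterPt (by omega) hg.1 (F := ξ q) (G := ξ q) ?_ hv
    simp only [h4]
    exact tendsto_const_nhds.mapClusterPt

lemma subsingleton_completeFlag_one : Subsingleton (CompleteFlag 1) := by
  refine ⟨fun F G => CompleteFlag.eq_of_le fun k => ?_⟩
  rcases Nat.lt_succ_iff_lt_or_eq.1 k.2 with hk | hk
  · have h1 := F.finrank_sub k
    rw [show (k : ℕ) = 0 by omega, Submodule.finrank_eq_zero] at h1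
    rw [h1]; exact bot_le
  · have h1 := G.finrank_sub k
    rw [Submodule.eq_top_of_finrank_eq (h1.trans (by rw [hk]; simp))]
    exact le_top

lemma exists_mem_cyclicLifts (m : ℕ) : ∃ θ, θ ∈ cyclicLifts m := by
  refine ⟨fun i => Real.arctan i, fun i j hij => Real.arctan_strictMono (by exact_mod_cast hij), ?_⟩
  have h1 := Real.arctan_lt_pi_div_two ((Fin.last m : Fin (m + 1)) : ℕ)
  simp only [Fin.val_zero, Nat.cast_zero, Real.arctan_zero]
  linarith [Real.pi_pos]

/-- A continuous transverse map from the circle to the flag manifold that intertwines some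
projective transformation with a unipotent element with a single Jordan block is positive. -/
theorem isPositiveMap_of_unipotent (hd : 1 ≤ d) (hc : Continuous ξ)
    (ht : ∀ x y, x ≠ y → (ξ x).Transverse (ξ y)) (hξ : ∀ x, ξ (γ • x) = g • ξ x)
    {P : GL (Fin d) ℝ}
    (h : ((P⁻¹ * g * P : GL (Fin d) ℝ) : Matrix (Fin d) (Fin d) ℝ) = jordanBlock d) :
    IsPositiveMap Set.univ ξ := by
  have hg := isRegularUnipotent_of_conj_eq_jordanBlock hd h
  refine isPositiveMap_of_exists hc ht fun m hm => ?_
  rcases hd.eq_or_lt with rfl | hd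
  · -- there is only one flag
    have := subsingleton_completeFlag_one
    obtain ⟨θ, hθ⟩ := exists_mem_cyclicLifts m
    obtain ⟨n, -, hn⟩ := hg.exists_isPositiveTuple (Subsingleton.elim _ _)
      (ht OnePoint.infty ((0 : ℝ) : OnePoint ℝ) (OnePoint.infty_ne_coe 0)) (m := m) (by omega)
    refine ⟨θ, hθ, ?_⟩
    convert hn
  · obtain ⟨p, hp, hu⟩ := exists_unique_fixedPoint hd hc ht hξ h
    obtain ⟨α, β, rfl, hβ, hγ⟩ := exists_translation hp hu
    rcases hβ.lt_or_gt with hβ | hβ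
    · exact exists_isPositiveTuple_of_translation hg hξ ht hβ hp hγ (by omega)
    · -- replacing `γ` and `g` by their inverses reverses the direction of the translation
      refine exists_isPositiveTuple_of_translation (γ := γ⁻¹) (β := -β) hg.inv (fun x => ?_) ht
        (by linarith) (by rw [inv_smul_eq_iff, hp]) (fun t => ?_) (by omega)
      · rw [eq_inv_smul_iff, ← hξ, smul_inv_smul]
      · rw [inv_smul_eq_iff, hγ, neg_add_cancel_right]

/-- Continuous, equivariant and transverse maps on a full limit set are positive, as soon as the
image of the representation contains a unipotent element with a single Jordan block. -/
theorem isPositiveMap_of_limitSet_eq_univ (hd : 1 ≤ d) {Γ : Subgroup PGL(Fin 2, ℝ)}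
    (hΛ : limitSet Γ = Set.univ) {ρ : Γ →* PGL(Fin d, ℝ)}
    (hu : ∃ γ : Γ, IsSingleBlockUnipotent (ρ γ)) (hc : ContinuousOn ξ (limitSet Γ))
    (he : IsEquivariant Γ ρ ξ) (ht : IsTransverseMap Γ ξ) : IsPositiveMap (limitSet Γ) ξ := by
  obtain ⟨γ, g, P, hg, hP⟩ := hu
  rw [hΛ] at hc ⊢
  have hmem : ∀ x, x ∈ limitSet Γ := fun x => hΛ ▸ Set.mem_univ x
  refine isPositiveMap_of_unipotent hd (continuousOn_univ.1 hc)
    (fun x y => ht x (hmem x) y (hmem y)) (γ := γ) (fun x => ?_) hP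
  rw [he γ x (hmem x), ← hg, mk_smul_flag]

end HitchinRigidity

theorem theorem1 (d : ℕ) (hd : 1 ≤ d) (Γ : Subgroup PGL(Fin 2, ℝ)) (hΓ : DiscreteTopology Γ)
    (hΛ : HitchinRigidity.limitSet Γ = Set.univ) (ρ : Γ →* PGL(Fin d, ℝ))
    (hu : ∃ γ : Γ, HitchinRigidity.IsSingleBlockUnipotent (ρ γ)) :
    (HitchinRigidity.IsBorelTransverse Γ ρ →
      HitchinRigidity.IsHitchin Γ ρ ∧
        ∀ ξ, HitchinRigidity.IsBorelTransverseLimitMap Γ ρ ξ →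
          HitchinRigidity.IsPositiveMap (HitchinRigidity.limitSet Γ) ξ) ∧
    (HitchinRigidity.IsGeometricallyFinite Γ → HitchinRigidity.IsCuspedBorelAnosov Γ ρ →
      HitchinRigidity.IsHitchin Γ ρ ∧
        ∀ ξ, HitchinRigidity.IsCuspedBorelAnosovLimitMap Γ ρ ξ →
          HitchinRigidity.IsPositiveMap (HitchinRigidity.limitSet Γ) ξ) := by
  have key := fun ξ => HitchinRigidity.isPositiveMap_of_limitSet_eq_univ (ξ := ξ) hd hΛ hu
  constructor
  · rintro ⟨ξ, hξ⟩
    exact ⟨⟨ξ, hξ.continuousOn, hξ.equivariant,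
      key ξ hξ.continuousOn hξ.equivariant hξ.transverse⟩,
      fun η hη => key η hη.continuousOn hη.equivariant hη.transverse⟩
  · rintro - ⟨ξ, hξ⟩
    exact ⟨⟨ξ, hξ.continuousOn, hξ.equivariant,
      key ξ hξ.continuousOn hξ.equivariant hξ.transverse⟩,
      fun η hη => key η hη.continuousOn hη.equivariant hη.transverse⟩
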